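/- For $n\ge 1$ let $w=\lfloor\sqrt n\rfloor$, $N=2^{w}$ and $q=\lfloor n^{1/3}/\log^2 n\rfloor$ (natural logarithm). Write $|x|$ for the number of ones of $x\in\{0,1\}^n$, and call $x$ a middle-layer string if $n/2-\sqrt n\le |x|\le n/2+\sqrt n$. **Distributions.** Let $\mathcal E$ be the uniform distribution on pairs $(T,C)$ with $T=(T_i)_{i\in[N]}$, $C=(C_{i,j})_{i,j\in[N]}$, where each $T_i$ and each $C_{i,j}$ is a map $[w]\to[n]$; put $T_i(x)=\bigwedge_{k}x_{T_i(k)}$ and $C_{i,j}(x)=\bigvee_k x_{C_{i,j}(k)}$. In $\mathcal E_{\mathrm{yes}}$ (respectively $\mathcal E_{\mathrm{no}}$), $H=(h_{i,j})_{i,j\in[N]}$ consists of independent functions $h_{i,j}(x)=x_{k}$ (respectively $h_{i,j}(x)=\overline{x_{k}}$) with $k=k_{i,j}$ uniform in $[n]$. $H$ is always drawn independently of $(T,C)$. **The function $f_{T,C,H}$.** Let $f(x)=1$ if $|x|>n/2+\sqrt n$ and $f(x)=0$ if $|x|<n/2-\sqrt n$. For a middle-layer string $x$: $f(x)=0$ if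 no $T_i(x)$ equals $1$; $f(x)=1$ if at least two of them do; if $T_i(x)=1$ for a unique $i$, then $f(x)=1$ if no $C_{i,j}(x)$ equals $0$, $f(x)=0$ if $C_{i,j}(x)=0$ for at least two $j$, and $f(x)=h_{i,j}(x)$ if $C_{i,j}(x)=0$ for a unique $j$. Let $\mathcal D_{\mathrm{yes}}$ and $\mathcal D_{\mathrm{no}}$ be the distributions of $f_{T,C,H}$ with $(T,C)\sim\mathcal E$ and $H\sim\mathcal E_{\mathrm{yes}}$, respectively $H\sim\mathcal E_{\mathrm{no}}$. **Full signatures.** Let $e_i\in\{0,1\}^N$ have its only $1$ at position $i$; for $i<i'$ let $e_{i,i'}\in\{0,1,*\}^N$ be $1$ at $i$ and $i'$, $0$ at the other positions before $i'$, and $*$ after $i'$; $\overline e_j$ and $\overline e_{j,j'}$ are obtained by exchanging $0$ and $1$. The full signature of $x$ with respect to $(T,C,H)$ is the tuple $(\sigma,\tau,a,b)$ defined as follows. The term signature $\sigma$ is $0^N$ if no $T_i(x)$ equals $1$, $e_i$ if $i$ is the only index with $T_i(x)=1$, and $e_{i,i'}$ if there are several, $i<i'$ being the two smallest. If $\sigma=e_i$,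 the clause signature $\tau$ is $1^N$ if no $C_{i,j}(x)$ equals $0$, $\overline e_j$ if $j$ is the only index with $C_{i,j}(x)=0$, and $\overline e_{j,j'}$ if there are several, $j<j'$ being the two smallest; otherwise $\tau=\perp$. If $\tau=\overline e_j$, then $a=h_{i,j}(x)$ and $b=\perp$; if $\tau=\overline e_{j,j'}$, then $a=h_{i,j}(x)$ and $b=h_{i,j'}(x)$; otherwise $a=b=\perp$. A $q$-query algorithm is a deterministic adaptive one, that is, a decision tree of depth at most $q$ whose internal nodes are labelled by query strings in $\{0,1\}^n$, whose edges are labelled by the possible oracle answers and whose leaves are labelled accept or reject. **Claim.** 1. There is a function $\varepsilon(n)\to0$ such that for every $n\ge1$ and every $q$-query algorithm $B$ that queries middle-layer strings only and receives as answer to each query $x$ the full signature of $x$ with respect to $(T,C,H)$, $$\Pr_{(T,C)\sim\mathcal E,\;H\sim\mathcal E_{\mathrm{yes}}}\big[B\text{ accepts }(T,C,H)\big]\le \Pr_{(T,C)\sim\mathcal E,\;H\sim\mathcal E_{\mathrm{no}}}\big[B\text{ accepts }(T,C,H)\big]+\varepsilon(n).$$ 2. There is a function $\varepsilon(n)\to0$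 such that for every $n\ge1$ and every $q$-query algorithm $B$ (with arbitrary queries in $\{0,1\}^n$) that receives $f(x)$ as answer to each query $x$, $$\Pr_{f\sim\mathcal D_{\mathrm{yes}}}\big[B\text{ accepts }f\big]\le \Pr_{f\sim\mathcal D_{\mathrm{no}}}\big[B\text{ accepts }f\big]+\varepsilon(n).$$ -/

import Mathlib

namespace MonoLB

/-! ### Parameters -/

/-- The width `√n` of the terms and clauses (rounded down when `n` is not a perfect square). -/
def width (n : ℕ) : ℕ := Nat.sqrt n

/-- `N = 2^√n`, the number of terms and the number of clauses below each term. -/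
def numN (n : ℕ) : ℕ := 2 ^ width n

/-- The number of queries `q = n^{1/3} / log² n`. The logarithm is the natural one, which gives
a larger `q`, hence more algorithms, than the logarithm in base `2`. -/
noncomputable def numQ (n : ℕ) : ℕ := ⌊(n : ℝ) ^ (1 / 3 : ℝ) / Real.log n ^ 2⌋₊

/-- The Boolean cube `{0,1}^n`. -/
abbrev Cube (n : ℕ) : Type := Fin n → Bool

/-- The Hamming weight `|x|`. -/
def weight {n : ℕ} (x : Cube n) : ℕ := (Finset.univ.filter fun k => x k = true).card

/-- The strings with `n/2 - √n ≤ |x| ≤ n/2 + √n`. -/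
def middleLayers (n : ℕ) : Set (Cube n) :=
  {x | (n : ℝ) / 2 - Real.sqrt n ≤ weight x ∧ (weight x : ℝ) ≤ (n : ℝ) / 2 + Real.sqrt n}

/-! ### Terms, clauses and bottom functions -/

/-- A sequence of terms `T_i : [√n] → [n]`, `i ∈ [N]`. -/
abbrev Terms (n : ℕ) : Type := Fin (numN n) → Fin (width n) → Fin n

/-- A family of clauses `C_{i,j} : [√n] → [n]`, `i, j ∈ [N]`. -/
abbrev Clauses (n : ℕ) : Type := Fin (numN n) → Fin (numN n) → Fin (width n) → Fin n

/-- A family of functions `h_{i,j} : {0,1}^n → {0,1}`, `i, j ∈ [N]`. -/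
abbrev Bottom (n : ℕ) : Type := Fin (numN n) → Fin (numN n) → Cube n → Bool

/-- A hidden triple `(T, C, H)`. -/
abbrev Triple (n : ℕ) : Type := (Terms n × Clauses n) × Bottom n

/-- The value of a term: the conjunction of its variables. -/
def termVal {n w : ℕ} (t : Fin w → Fin n) (x : Cube n) : Bool := decide (∀ k, x (t k) = true)

/-- The value of a clause: the disjunction of its variables. -/
def clauseVal {n w : ℕ} (c : Fin w → Fin n) (x : Cube n) : Bool := decide (∃ k, x (c k) = true)

/-- The set of `i` with `T_i(x) = 1`. -/
def satTerms {n : ℕ} (T : Terms n) (x : Cube n) : Finset (Fin (numN n)) :=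
  Finset.univ.filter fun i => termVal (T i) x = true

/-- The set of `j` with `C_{i,j}(x) = 0`. -/
def falsClauses {n : ℕ} (C : Clauses n) (i : Fin (numN n)) (x : Cube n) :
    Finset (Fin (numN n)) :=
  Finset.univ.filter fun j => clauseVal (C i j) x = false

/-! ### None, one, or several indices -/

/-- What is recorded about a set of indices: it is empty, or its unique element, or its two
smallest elements. -/
inductive Hits (N : ℕ) : Type
  | none : Hits N
  | one (i : Fin N) : Hits N
  | many (i i' : Fin N) (h : i < i') : Hits N

theorem min_lt_min_erase {N : ℕ} (s : Finset (Fin N)) (h : s.Nonempty)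
    (h' : (s.erase (s.min' h)).Nonempty) :
    s.min' h < (s.erase (s.min' h)).min' h' :=
  Finset.min'_lt_of_mem_erase_min' s h (Finset.min'_mem _ h')

def hits {N : ℕ} (s : Finset (Fin N)) : Hits N :=
  if h : s.Nonempty then
    if h' : (s.erase (s.min' h)).Nonempty then
      Hits.many (s.min' h) ((s.erase (s.min' h)).min' h') (min_lt_min_erase s h h')
    else Hits.one (s.min' h)
  else Hits.none

/-! ### The multiplexer and the function `f_{T,C,H}` -/

/-- The values of the multiplexer map: `0^*`, `1^*`, or a pair `(i, j)`. -/
inductive MuxVal (N : ℕ) : Type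
  | zeroStar : MuxVal N
  | oneStar : MuxVal N
  | pair (i j : Fin N) : MuxVal N

/-- The multiplexer map `Γ_{T,C}`. -/
def mux {n : ℕ} (T : Terms n) (C : Clauses n) (x : Cube n) : MuxVal (numN n) :=
  match hits (satTerms T x) with
  | Hits.none => MuxVal.zeroStar
  | Hits.many _ _ _ => MuxVal.oneStar
  | Hits.one i =>
    match hits (falsClauses C i x) with
    | Hits.none => MuxVal.oneStar
    | Hits.many _ _ _ => MuxVal.zeroStar
    | Hits.one j => MuxVal.pair i j

/-- The truncated function `f_{T,C,H}`. -/
noncomputable def fTCH {n : ℕ} (ω : Triple n) (x : Cube n) : Bool :=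
  open Classical in
  if (n : ℝ) / 2 + Real.sqrt n < weight x then true
  else if (weight x : ℝ) < (n : ℝ) / 2 - Real.sqrt n then false
  else
    match mux ω.1.1 ω.1.2 x with
    | MuxVal.zeroStar => false
    | MuxVal.oneStar => true
    | MuxVal.pair i j => ω.2 i j x

/-! ### Full signatures -/

/-- The alphabet `{0, 1, *}`. -/
inductive Entry : Type
  | zero : Entry
  | one : Entry
  | star : Entry

/-- The string with entry `v` at `i` and entry `u` elsewhere. -/
def strOne {N : ℕ} (u v : Entry) (i : Fin N) : Fin N → Entry :=
  fun k => if k = i then v else u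

/-- The string with entry `v` at `i` and at `i'`, entry `u` at the other positions before `i'`,
and `*` after `i'` (used for `i < i'`). -/
def strTwo {N : ℕ} (u v : Entry) (i i' : Fin N) : Fin N → Entry :=
  fun k => if k = i ∨ k = i' then v else if k < i' then u else Entry.star

/-- `e_i`. -/
def eOne {N : ℕ} (i : Fin N) : Fin N → Entry := strOne Entry.zero Entry.one i

/-- `e_{i,i'}`. -/
def eTwo {N : ℕ} (i i' : Fin N) : Fin N → Entry := strTwo Entry.zero Entry.one i i'

/-- `ē_j`, which is `e_j` with `0` and `1` exchanged. -/
def eBarOne {N : ℕ} (j : Fin N) : Fin N → Entry := strOne Entry.one Entry.zero j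

/-- `ē_{j,j'}`, which is `e_{j,j'}` with `0` and `1` exchanged. -/
def eBarTwo {N : ℕ} (j j' : Fin N) : Fin N → Entry := strTwo Entry.one Entry.zero j j'

/-- A tuple `(σ, τ, a, b)`; the symbol `⊥` is `none`. -/
@[ext]
structure SigTuple (N : ℕ) : Type where
  σ : Fin N → Entry
  τ : Option (Fin N → Entry)
  a : Option Bool
  b : Option Bool

/-- The syntactic conditions on a full signature. -/
inductive IsSig {N : ℕ} : SigTuple N → Prop
  | noTerm : IsSig ⟨fun _ => Entry.zero, none, none, none⟩
  | manyTerms (i i' : Fin N) (h : i < i') : IsSig ⟨eTwo i i', none, none, none⟩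
  | noClause (i : Fin N) : IsSig ⟨eOne i, some fun _ => Entry.one, none, none⟩
  | oneClause (i j : Fin N) (a : Bool) : IsSig ⟨eOne i, some (eBarOne j), some a, none⟩
  | manyClauses (i j j' : Fin N) (h : j < j') (a b : Bool) :
      IsSig ⟨eOne i, some (eBarTwo j j'), some a, some b⟩

/-- The set of all full signatures. -/
abbrev Sig (N : ℕ) : Type := {p : SigTuple N // IsSig p}

/-- The full signature of `x` with respect to `(T, C, H)`. -/
def fullSig {n : ℕ} (ω : Triple n) (x : Cube n) : Sig (numN n) :=
  match hits (satTerms ω.1.1 x) with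
  | Hits.none => ⟨_, IsSig.noTerm⟩
  | Hits.many i i' h => ⟨_, IsSig.manyTerms i i' h⟩
  | Hits.one i =>
    match hits (falsClauses ω.1.2 i x) with
    | Hits.none => ⟨_, IsSig.noClause i⟩
    | Hits.one j => ⟨_, IsSig.oneClause i j (ω.2 i j x)⟩
    | Hits.many j j' h => ⟨_, IsSig.manyClauses i j j' h (ω.2 i j x) (ω.2 i j' x)⟩

/-! ### Deterministic query algorithms -/

/-- A deterministic algorithm as a decision tree: queries in `X`, oracle answers in `A`, and
leaves labelled `true` (accept) or `false` (reject). -/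
inductive QTree (X A : Type) : Type
  | leaf (label : Bool) : QTree X A
  | node (query : X) (child : A → QTree X A) : QTree X A

namespace QTree

variable {X A : Type}

/-- The label of the leaf that is reached with the oracle `O`. -/
def run (O : X → A) : QTree X A → Bool
  | leaf l => l
  | node x child => run O (child (O x))

/-- The algorithm makes at most `d` queries on each path. -/
def DepthLE : QTree X A → ℕ → Prop
  | leaf _, _ => True
  | node _ _, 0 => False
  | node _ child, d + 1 => ∀ a, DepthLE (child a) d

/-- All queries in the tree belong to `S`. -/
def QueriesIn (S : Set X) : QTree X A → Prop
  | leaf _ => True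
  | node x child => x ∈ S ∧ ∀ a, QueriesIn S (child a)

end QTree

/-! ### Distributions -/

/-- The distribution `𝓔` of `(T, C)`. -/
noncomputable def distE (n : ℕ) [NeZero n] : PMF (Terms n × Clauses n) :=
  PMF.uniformOfFintype _

/-- The distribution `𝓔_yes` of `H`: independent uniform dictators `h_{i,j}(x) = x_k`. -/
noncomputable def distEyes (n : ℕ) [NeZero n] : PMF (Bottom n) :=
  (PMF.uniformOfFintype (Fin (numN n) → Fin (numN n) → Fin n)).map
    fun κ i j x => x (κ i j)

/-- The distribution `𝓔_no` of `H`: independent uniform anti-dictators `h_{i,j}(x) = ¬ x_k`. -/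
noncomputable def distEno (n : ℕ) [NeZero n] : PMF (Bottom n) :=
  (PMF.uniformOfFintype (Fin (numN n) → Fin (numN n) → Fin n)).map
    fun κ i j x => !(x (κ i j))

/-- The law of `(T, C, H)` with `(T, C) ∼ 𝓔` and, independently, `H ∼ μ`. -/
noncomputable def tripleLaw {n : ℕ} [NeZero n] (μ : PMF (Bottom n)) : PMF (Triple n) :=
  (distE n).bind fun TC => μ.map fun H => (TC, H)

/-- The distribution `𝓓_yes` of `f_{T,C,H}`. -/
noncomputable def distDyes (n : ℕ) [NeZero n] : PMF (Cube n → Bool) :=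
  (tripleLaw (distEyes n)).map fTCH

/-- The distribution `𝓓_no` of `f_{T,C,H}`. -/
noncomputable def distDno (n : ℕ) [NeZero n] : PMF (Cube n → Bool) :=
  (tripleLaw (distEno n)).map fTCH

/-- The probability of an event. -/
noncomputable def Pr {α : Type} (p : PMF α) (S : Set α) : ℝ := (p.toOuterMeasure S).toReal

end MonoLB

/-! Both real worlds are compared with an ideal world in which every `h_{i,j}` is a constant, chosen
by a fair coin. This world does not know the sign, so it is enough that each real world gives every
outcome at least its ideal probability up to `o(1)`. One-sided bounds suffice because the two
outcomes have total probability 1.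

Fix `(T, C)` and a run in the ideal world. A real world reproduces its transcript if, for each
recorded clause `j`, the hidden coordinate `κ j` lies in the set `agree` of positions at which all
queries that recorded `j` take one prescribed value. These events are independent over `j`, and
ideally each has probability `1/2`. So the sizes of `agree` have to be close to `n/2`;
`ideal_le_real` passes from transcripts to outcomes.

A recorded term or clause has all its variables in `common`, the positions where every string that
recorded it has the right value. Apart from this, the answers only say that some queries give it the
other value, and one variable per query certifies that. Hence at least `w - q` of the `w` variables
behave as if uniform in `common` (`card_filter_forall_mem_le`), and a query that would remove more
than `Δ` common positions records the index again with probability at most `exp(-Δ/n)^(w-q)`. With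
`Δ = 4 √n log n` this is at most `n⁻²` for large `n`, so almost all transcripts are good
(`card_not_goodHist_le`).

On a good transcript, let a clause be recorded `m` times. The positions where all these strings are
0 number about `n/2`, up to a loss of order `m Δ`. For the value 1 there are two bounds: the term
above the clause loses at most `q Δ`, while comparing the strings with one of them, whose weight is
nearly the same, loses at most `m² Δ`. The smaller loss is at most `√q m Δ` (`card_agree_ge`). The
numbers `m` add up to at most `2q`, so the total relative loss is of order `q^(3/2) Δ / n = O(1 /
log² n)`, which is where the exponent `1/3` comes from. -/

namespace MonoLB

/-! ### Resampling tuples outside a certificate -/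

/-- Every tuple of `U` with all entries in `X` stays in `U` when the entries outside at most `m`
positions are changed arbitrarily inside `A`; then such tuples form a small part of `U`. -/
theorem card_filter_forall_mem_le {V : Type*} [DecidableEq V] {w m : ℕ} {A X : Finset V}
    (hXA : X ⊆ A) (U : Finset (Fin w → V))
    (hU : ∀ T ∈ U, (∀ k, T k ∈ X) → ∃ K : Finset (Fin w), K.card ≤ m ∧
      ∀ T' : Fin w → V, (∀ k, T' k ∈ A) → (∀ k ∈ K, T' k = T k) → T' ∈ U) :
    ((U.filter fun T => ∀ k, T k ∈ X).card : ℝ) ≤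
      ((X.card : ℝ) / A.card) ^ (w - m) * U.card := by
  classical
  rcases le_total w m with hwm | hmw
  · rw [Nat.sub_eq_zero_of_le hwm, pow_zero, one_mul]
    exact_mod_cast Finset.card_filter_le _ _
  rcases X.eq_empty_or_nonempty with rfl | hX
  · rcases Nat.eq_zero_or_pos w with rfl | hw
    · simp
    · have : (U.filter fun T => ∀ k, T k ∈ (∅ : Finset V)) = ∅ := by
        apply Finset.filter_false_of_mem
        intro T _ h
        exact absurd (h ⟨0, hw⟩) (Finset.notMem_empty _)
      rw [this]
      simp only [Finset.card_empty, Nat.cast_zero]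
      positivity
  have hx : (0 : ℝ) < X.card := by exact_mod_cast hX.card_pos
  have ha : (0 : ℝ) < A.card := by exact_mod_cast (hX.mono hXA).card_pos
  have hxa : (X.card : ℝ) ≤ A.card := by exact_mod_cast Finset.card_le_card hXA
  choose! K hKm hK using hU
  set x : ℝ := (X.card : ℝ) with hxdef
  set a : ℝ := (A.card : ℝ) with hadef
  -- Resampling of one entry `t ∈ X`: draw a uniform element of `A`, move there if it is outside
  -- `X`, otherwise keep `t`. Rows sum to 1 over `A`, and every column sums to `x / a` over `X`.
  let r : V → V → ℝ := fun t t' => (if t' = t then x / a else 0) + (if t' ∈ X then 0 else 1 / a)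
  have hr0 : ∀ t t', 0 ≤ r t t' := by
    intro t t'
    simp only [r]
    split_ifs <;> positivity
  let p : (Fin w → V) → (Fin w → V) → ℝ := fun T T' =>
    ∏ k, if k ∈ K T then (if T' k = T k then 1 else 0) else r (T k) (T' k)
  have hp0 : ∀ T T', 0 ≤ p T T' := fun T T' => Finset.prod_nonneg fun k _ => by
    split_ifs
    · exact zero_le_one
    · exact le_rfl
    · exact hr0 _ _
  have hrow : ∀ T ∈ U, (∀ k, T k ∈ X) → 1 ≤ ∑ T' ∈ U, p T T' := by
    intro T hT hTX
    have h1 : ∑ T' ∈ Fintype.piFinset (fun _ : Fin w => A), p T T' = 1 := by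
      simp only [p]
      rw [← Finset.prod_univ_sum (fun _ : Fin w => A) (fun k v =>
        if k ∈ K T then (if v = T k then (1 : ℝ) else 0) else r (T k) v)]
      refine Finset.prod_eq_one fun k _ => ?_
      split_ifs with hk
      · rw [Finset.sum_ite_eq' A (T k), if_pos (hXA (hTX k))]
      · simp only [r]
        rw [Finset.sum_add_distrib, Finset.sum_ite_eq' A (T k), if_pos (hXA (hTX k)),
          Finset.sum_ite, Finset.sum_const_zero, zero_add, Finset.sum_const, nsmul_eq_mul]
        have : ((A.filter fun v => v ∉ X).card : ℝ) = a - x := by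
          rw [Finset.filter_notMem_eq_sdiff, Finset.cast_card_sdiff hXA]
        rw [this]
        field_simp
        ring
    rw [← h1]
    -- A tuple of nonzero weight agrees with `T` on `K T`, so the certificate keeps it in `U`.
    rw [← Finset.sum_filter_of_ne (p := fun T' => T' ∈ U)]
    · refine Finset.sum_le_sum_of_subset_of_nonneg (fun T' hT' => (Finset.mem_filter.1 hT').2)
        fun T' _ _ => hp0 _ _
    intro T' hT' hne
    refine hK T hT hTX T' (fun k => Fintype.mem_piFinset.1 hT' k) fun k hk => ?_
    by_contra hkk
    refine hne (Finset.prod_eq_zero (Finset.mem_univ k) ?_)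
    rw [if_pos hk, if_neg hkk]
  have hcol : ∀ T', ∑ T ∈ U.filter (fun T => ∀ k, T k ∈ X), p T T' ≤ (x / a) ^ (w - m) := by
    intro T'
    -- Freezing an entry instead of resampling it costs a factor `a / x`, since a resampled entry
    -- stays put with probability `x / a`.
    have h1 : ∀ T ∈ U.filter (fun T => ∀ k, T k ∈ X),
        p T T' ≤ (a / x) ^ m * ∏ k, r (T k) (T' k) := by
      intro T hT
      rw [Finset.mem_filter] at hT
      have hax : 1 ≤ a / x := (one_le_div hx).2 hxa
      calc p T T' ≤ ∏ k, (if k ∈ K T then a / x else 1) * r (T k) (T' k) := by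
            refine Finset.prod_le_prod (fun k _ => ?_) fun k _ => ?_
            · split_ifs
              · exact zero_le_one
              · exact le_rfl
              · exact hr0 _ _
            · by_cases hk : k ∈ K T
              · rw [if_pos hk, if_pos hk]
                split_ifs with h
                · have : r (T k) (T' k) = x / a := by
                    simp only [r]
                    rw [if_pos h, h, if_pos (hT.2 k), add_zero]
                  rw [this]
                  field_simp
                  exact le_rfl
                · exact mul_nonneg (by positivity) (hr0 _ _)
              · rw [if_neg hk, if_neg hk, one_mul]
        _ = (a / x) ^ (K T).card * ∏ k, r (T k) (T' k) := by
            rw [Finset.prod_mul_distrib, Finset.prod_ite_mem, Finset.univ_inter,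
              Finset.prod_const]
        _ ≤ _ := by
            refine mul_le_mul_of_nonneg_right (pow_le_pow_right₀ hax (hKm T hT.1 hT.2))
              (Finset.prod_nonneg fun k _ => hr0 _ _)
    have h2 : ∑ T ∈ U.filter (fun T => ∀ k, T k ∈ X), ∏ k, r (T k) (T' k) ≤
        ∑ T ∈ Fintype.piFinset (fun _ : Fin w => X), ∏ k, r (T k) (T' k) := by
      refine Finset.sum_le_sum_of_subset_of_nonneg (fun T hT => ?_) fun T _ _ =>
        Finset.prod_nonneg fun k _ => hr0 _ _
      exact Fintype.mem_piFinset.2 (Finset.mem_filter.1 hT).2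
    have h3 : ∑ T ∈ Fintype.piFinset (fun _ : Fin w => X), ∏ k, r (T k) (T' k) = (x / a) ^ w := by
      rw [← Finset.prod_univ_sum (fun _ : Fin w => X) (fun k t => r t (T' k))]
      rw [Finset.prod_congr rfl (g := fun _ => x / a), Finset.prod_const, Finset.card_univ,
        Fintype.card_fin]
      intro k _
      simp only [r]
      rw [Finset.sum_add_distrib, Finset.sum_ite_eq, Finset.sum_const, nsmul_eq_mul]
      split_ifs
      · ring
      · change 0 + x * (1 / a) = x / a
        ring
    calc ∑ T ∈ U.filter (fun T => ∀ k, T k ∈ X), p T T'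
        ≤ ∑ T ∈ U.filter (fun T => ∀ k, T k ∈ X), (a / x) ^ m * ∏ k, r (T k) (T' k) :=
          Finset.sum_le_sum h1
      _ = (a / x) ^ m * ∑ T ∈ U.filter (fun T => ∀ k, T k ∈ X), ∏ k, r (T k) (T' k) := by
          rw [Finset.mul_sum]
      _ ≤ (a / x) ^ m * (x / a) ^ w := by
          rw [← h3]
          exact mul_le_mul_of_nonneg_left h2 (by positivity)
      _ = (x / a) ^ (w - m) := by
          obtain ⟨d, rfl⟩ := Nat.exists_eq_add_of_le hmw
          rw [Nat.add_sub_cancel_left, pow_add, ← mul_assoc, ← mul_pow, div_mul_div_cancel₀ hx.ne',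
            div_self ha.ne', one_pow, one_mul]
  calc ((U.filter fun T => ∀ k, T k ∈ X).card : ℝ)
      = ∑ T ∈ U.filter (fun T => ∀ k, T k ∈ X), 1 := by simp
    _ ≤ ∑ T ∈ U.filter (fun T => ∀ k, T k ∈ X), ∑ T' ∈ U, p T T' :=
        Finset.sum_le_sum fun T hT => hrow T (Finset.mem_filter.1 hT).1 (Finset.mem_filter.1 hT).2
    _ = ∑ T' ∈ U, ∑ T ∈ U.filter (fun T => ∀ k, T k ∈ X), p T T' := Finset.sum_comm
    _ ≤ ∑ T' ∈ U, (x / a) ^ (w - m) := Finset.sum_le_sum fun T' _ => hcol T'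
    _ = (x / a) ^ (w - m) * U.card := by rw [Finset.sum_const, nsmul_eq_mul, mul_comm]

/-- The same for one coordinate of a family of tuples. -/
theorem card_filter_forall_mem_le_of_update {ι V : Type*} [Fintype ι] [DecidableEq ι] [Fintype V]
    [DecidableEq V] {w m : ℕ} {A X : Finset V} (hXA : X ⊆ A) (α : ι)
    (S : Finset (ι → Fin w → V))
    (hS : ∀ F ∈ S, (∀ k, F α k ∈ X) → ∃ K : Finset (Fin w), K.card ≤ m ∧
      ∀ T' : Fin w → V, (∀ k, T' k ∈ A) → (∀ k ∈ K, T' k = F α k) →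
        Function.update F α T' ∈ S) :
    ((S.filter fun F => ∀ k, F α k ∈ X).card : ℝ) ≤
      ((X.card : ℝ) / A.card) ^ (w - m) * S.card := by
  classical
  let rest : (ι → Fin w → V) → ({j // j ≠ α} → Fin w → V) := fun F j => F j
  have glue : ∀ F F' : ι → Fin w → V, rest F = rest F' → F = Function.update F' α (F α) := by
    intro F F' h
    funext j
    by_cases hj : j = α
    · subst hj; simp
    · rw [Function.update_of_ne hj]
      exact congrFun h ⟨j, hj⟩
  -- With the other coordinates fixed, this is the statement for one tuple; the fibers then add up.
  have key : ∀ G : {j // j ≠ α} → Fin w → V,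
      (((S.filter fun F => ∀ k, F α k ∈ X).filter fun F => rest F = G).card : ℝ) ≤
        ((X.card : ℝ) / A.card) ^ (w - m) * (S.filter fun F => rest F = G).card := by
    intro G
    rcases (S.filter fun F => rest F = G).eq_empty_or_nonempty with h | ⟨F₀, hF₀⟩
    · have h' : ((S.filter fun F => ∀ k, F α k ∈ X).filter fun F => rest F = G) = ∅ := by
        rw [Finset.filter_comm, h, Finset.filter_empty]
      rw [h, h']; simp
    rw [Finset.mem_filter] at hF₀
    let U : Finset (Fin w → V) := Finset.univ.filter fun T => Function.update F₀ α T ∈ S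
    have hrest : ∀ T, rest (Function.update F₀ α T) = G := by
      intro T
      rw [← hF₀.2]
      funext j
      exact Function.update_of_ne j.2 _ _
    have inj : Function.Injective (Function.update F₀ α) := Function.update_injective _ _
    have e1 : (S.filter fun F => rest F = G) = U.image (Function.update F₀ α) := by
      ext F
      simp only [Finset.mem_filter, Finset.mem_image, U, Finset.mem_univ, true_and]
      constructor
      · rintro ⟨h1, h2⟩
        have := glue F F₀ (h2.trans hF₀.2.symm)
        exact ⟨F α, this ▸ h1, this.symm⟩
      · rintro ⟨T, hT, rfl⟩
        exact ⟨hT, hrest T⟩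
    have e2 : ((S.filter fun F => ∀ k, F α k ∈ X).filter fun F => rest F = G) =
        (U.filter fun T => ∀ k, T k ∈ X).image (Function.update F₀ α) := by
      rw [Finset.filter_comm, e1, Finset.filter_image]
      simp only [Function.update_self]
    rw [e1, e2, Finset.card_image_of_injective _ inj, Finset.card_image_of_injective _ inj]
    refine card_filter_forall_mem_le hXA U fun T hT hTX => ?_
    simp only [U, Finset.mem_filter, Finset.mem_univ, true_and] at hT ⊢
    obtain ⟨K, hK, hK'⟩ := hS _ hT (by simpa using hTX)
    refine ⟨K, hK, fun T' h1 h2 => ?_⟩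
    simpa using hK' T' h1 (by simpa using h2)
  rw [Finset.card_eq_sum_card_fiberwise (f := rest) (t := Finset.univ) (s := S)
      (fun _ _ => Finset.mem_coe.2 (Finset.mem_univ _)),
    Finset.card_eq_sum_card_fiberwise (f := rest) (t := Finset.univ)
      (s := S.filter fun F => ∀ k, F α k ∈ X) (fun _ _ => Finset.mem_coe.2 (Finset.mem_univ _))]
  push_cast
  rw [Finset.mul_sum]
  exact Finset.sum_le_sum fun G _ => key G

/-! ### Transcripts of decision trees -/

namespace QTree

variable {A' X A : Type}

/-- The list of the queries and answers, the latest first, put in front of `H`. -/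
def transcript (O : X → A) : QTree X A → List (X × A) → List (X × A)
  | leaf _, H => H
  | node x child, H => transcript O (child (O x)) ((x, O x) :: H)

theorem mem_transcript_of_mem (O : X → A) (B : QTree X A) :
    ∀ (H : List (X × A)) {p : X × A}, p ∈ H → p ∈ B.transcript O H := by
  induction B with
  | leaf l => exact fun H p hp => hp
  | node x child ih => exact fun H p hp => ih _ _ (List.mem_cons_of_mem _ hp)

theorem eq_oracle_of_mem_transcript (O : X → A) (B : QTree X A) :
    ∀ (H : List (X × A)), (∀ p ∈ H, p.2 = O p.1) → ∀ p ∈ B.transcript O H, p.2 = O p.1 := by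
  induction B with
  | leaf l => exact fun H h => h
  | node x child ih =>
    intro H h
    refine ih _ _ fun p hp => ?_
    rcases List.mem_cons.1 hp with rfl | hp
    · rfl
    · exact h p hp

theorem queriesIn_transcript (O : X → A) {S : Set X} (B : QTree X A) (hB : B.QueriesIn S) :
    ∀ (H : List (X × A)), (∀ p ∈ H, p.1 ∈ S) → ∀ p ∈ B.transcript O H, p.1 ∈ S := by
  induction B with
  | leaf l => exact fun H h => h
  | node x child ih =>
    intro H h
    refine ih _ (hB.2 _) _ fun p hp => ?_
    rcases List.mem_cons.1 hp with rfl | hp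
    · exact hB.1
    · exact h p hp

theorem length_transcript_le (O : X → A) (B : QTree X A) :
    ∀ (H : List (X × A)) (d : ℕ), B.DepthLE d → (B.transcript O H).length ≤ H.length + d := by
  induction B with
  | leaf l => exact fun H d _ => Nat.le_add_right _ _
  | node x child ih =>
    rintro H (_ | d) hd
    · exact hd.elim
    · have := ih (O x) ((x, O x) :: H) d (hd _)
      simp only [List.length_cons] at this
      simp only [transcript]
      omega

/-- A deterministic run consults its oracle only along its own path. -/
theorem transcript_run_congr (O O' : X → A) (B : QTree X A) :
    ∀ H : List (X × A), (∀ p ∈ B.transcript O H, O' p.1 = p.2) →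
      B.transcript O' H = B.transcript O H ∧ B.run O' = B.run O := by
  induction B with
  | leaf l => exact fun H _ => ⟨rfl, rfl⟩
  | node x child ih =>
    intro H h
    have hx : O' x = O x :=
      h (x, O x) (mem_transcript_of_mem O (child (O x)) _ List.mem_cons_self)
    simp only [transcript, run, hx]
    exact ih _ _ h

/-- The tree for an oracle whose answers are translated by `g`. -/
def comapAnswer (g : A' → A) : QTree X A → QTree X A'
  | leaf l => leaf l
  | node x child => node x fun a => comapAnswer g (child (g a))

theorem run_comapAnswer (g : A' → A) (O : X → A') (B : QTree X A) :
    (B.comapAnswer g).run O = B.run fun x => g (O x) := by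
  induction B with
  | leaf l => rfl
  | node x child ih => exact ih _

theorem depthLE_comapAnswer (g : A' → A) (B : QTree X A) :
    ∀ d, B.DepthLE d → (B.comapAnswer g).DepthLE d := by
  induction B with
  | leaf l => exact fun _ _ => trivial
  | node x child ih =>
    rintro (_ | d) hd
    · exact hd
    · exact fun a => ih _ d (hd _)

theorem queriesIn_comapAnswer (g : A' → A) {S : Set X} (B : QTree X A) (hB : B.QueriesIn S) :
    (B.comapAnswer g).QueriesIn S := by
  induction B with
  | leaf l => trivial
  | node x child ih => exact ⟨hB.1, fun a => ih _ (hB.2 _)⟩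

end QTree

/-! ### From transcripts to outcomes -/

/-- Comparison of two worlds for a tree whose oracle depends on the bits `b j`, `j ∈ touch x`: in
the ideal world the bits are uniform, in the real one the bit of `j` seen at `x` is `φ x (κ j)`
with `κ` uniform. If the real world is, up to a factor `1 - δ`, at least as likely as the ideal one
to produce the transcript of every `b ∈ G`, it produces the outcome `l` with at least `1 - δ` times
the ideal probability of `l` and `G`. -/
theorem ideal_le_real {X A V J : Type} [Fintype J] [DecidableEq J] [Fintype V] [Nonempty V]
    (ans : (J → Bool) → X → A) (touch : X → Finset J)
    (hans : ∀ b b' x, (∀ j ∈ touch x, b j = b' j) → ans b x = ans b' x)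
    (φ : X → V → Bool) (B : QTree X A) (l : Bool) (δ : ℝ) (G : Set (J → Bool))
    (seen : (J → Bool) → Finset J)
    (hseen : ∀ b j, j ∈ seen b ↔ ∃ p ∈ B.transcript (ans b) [], j ∈ touch p.1)
    (hG : ∀ b ∈ G, (1 - δ) * (Fintype.card V : ℝ) ^ Fintype.card J ≤ 2 ^ (seen b).card *
      (Nat.card {κ : J → V | ∀ p ∈ B.transcript (ans b) [], ∀ j ∈ touch p.1,
        φ p.1 (κ j) = b j} : ℝ)) :
    (1 - δ) * ((Nat.card {b | b ∈ G ∧ B.run (ans b) = l} : ℝ) / 2 ^ Fintype.card J) ≤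
      (Nat.card {κ : J → V | B.run (fun x => ans (fun j => φ x (κ j)) x) = l} : ℝ) /
        (Fintype.card V : ℝ) ^ Fintype.card J := by
  classical
  have hV : (0 : ℝ) < (Fintype.card V : ℝ) ^ Fintype.card J :=
    pow_pos (by exact_mod_cast Fintype.card_pos) _
  have h2 : (0 : ℝ) < 2 ^ Fintype.card J := by positivity
  -- The bits produced by `κ` match `b` wherever the run on `b` reads them, so the two runs
  -- coincide.
  let R : (J → V) → (J → Bool) → Prop := fun κ b =>
    ∀ p ∈ B.transcript (ans b) [], ∀ j ∈ touch p.1, φ p.1 (κ j) = b j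
  have hR : ∀ κ b, R κ b →
      B.transcript (fun x => ans (fun j => φ x (κ j)) x) [] = B.transcript (ans b) [] ∧
      B.run (fun x => ans (fun j => φ x (κ j)) x) = B.run (ans b) := by
    intro κ b h
    refine QTree.transcript_run_congr _ _ B [] fun p hp => ?_
    rw [QTree.eq_oracle_of_mem_transcript (ans b) B [] (by simp) p hp]
    exact hans _ _ _ fun j hj => h p hp j hj
  let g : Finset (J → Bool) := Finset.univ.filter fun b => b ∈ G ∧ B.run (ans b) = l
  let k : Finset (J → V) :=
    Finset.univ.filter fun κ => B.run (fun x => ans (fun j => φ x (κ j)) x) = l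
  have hg : Nat.card {b | b ∈ G ∧ B.run (ans b) = l} = g.card := by
    rw [Nat.card_eq_fintype_card, Fintype.card_subtype]; rfl
  have hk : Nat.card {κ : J → V | B.run (fun x => ans (fun j => φ x (κ j)) x) = l} = k.card := by
    rw [Nat.card_eq_fintype_card, Fintype.card_subtype]; rfl
  have hS : ∀ b, Nat.card {κ : J → V | ∀ p ∈ B.transcript (ans b) [], ∀ j ∈ touch p.1,
        φ p.1 (κ j) = b j} = (Finset.univ.filter fun κ => R κ b).card := by
    intro b
    rw [Nat.card_eq_fintype_card, Fintype.card_subtype]; rfl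
  -- All `b` compatible with one `κ` have the transcript of the run on `κ`. They share `seen` and
  -- their values on it, so only the bits outside `seen` are free.
  have hfib : ∀ κ, ∑ b ∈ g.filter (fun b => R κ b), (2 : ℝ) ^ (seen b).card ≤
      2 ^ Fintype.card J := by
    intro κ
    rcases (g.filter fun b => R κ b).eq_empty_or_nonempty with h | ⟨b₀, hb₀⟩
    · rw [h, Finset.sum_empty]; positivity
    have hb₀' := (Finset.mem_filter.1 hb₀).2
    have hseen' : ∀ b, R κ b → seen b = seen b₀ := by
      intro b hb
      ext j
      rw [hseen, hseen, ← (hR κ b hb).1, (hR κ b₀ hb₀').1]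
    have hsub : g.filter (fun b => R κ b) ⊆
        Fintype.piFinset fun j => if j ∈ seen b₀ then {b₀ j} else Finset.univ := by
      intro b hb
      have hb' := (Finset.mem_filter.1 hb).2
      rw [Fintype.mem_piFinset]
      intro j
      split_ifs with hj
      · obtain ⟨p, hp, hpj⟩ := (hseen b₀ j).1 hj
        rw [Finset.mem_singleton, ← hb₀' p hp j hpj]
        rw [← (hR κ b₀ hb₀').1, (hR κ b hb').1] at hp
        exact (hb' p hp j hpj).symm
      · exact Finset.mem_univ _
    have hcard : (Fintype.piFinset fun j =>
        if j ∈ seen b₀ then {b₀ j} else (Finset.univ : Finset Bool)).card =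
        2 ^ (Fintype.card J - (seen b₀).card) := by
      rw [Fintype.card_piFinset, ← Finset.card_univ, ← Finset.card_sdiff_of_subset
        (Finset.subset_univ (seen b₀)), ← Finset.prod_const, ← Finset.prod_sdiff
        (Finset.subset_univ (seen b₀)), Finset.prod_eq_one (s := seen b₀), mul_one]
      · refine Finset.prod_congr rfl fun j hj => ?_
        rw [if_neg (Finset.mem_sdiff.1 hj).2, Finset.card_univ, Fintype.card_bool]
      · intro j hj
        rw [if_pos hj, Finset.card_singleton]
    calc ∑ b ∈ g.filter (fun b => R κ b), (2 : ℝ) ^ (seen b).card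
        = ∑ b ∈ g.filter (fun b => R κ b), (2 : ℝ) ^ (seen b₀).card :=
          Finset.sum_congr rfl fun b hb => by rw [hseen' b (Finset.mem_filter.1 hb).2]
      _ = (g.filter fun b => R κ b).card * (2 : ℝ) ^ (seen b₀).card := by
          rw [Finset.sum_const, nsmul_eq_mul]
      _ ≤ 2 ^ (Fintype.card J - (seen b₀).card) * (2 : ℝ) ^ (seen b₀).card := by
          refine mul_le_mul_of_nonneg_right ?_ (by positivity)
          exact_mod_cast hcard ▸ Finset.card_le_card hsub
      _ = 2 ^ Fintype.card J := by
          rw [← pow_add, Nat.sub_add_cancel (Finset.card_le_univ _)]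
  rw [hg, hk, mul_div_assoc', div_le_div_iff₀ h2 hV]
  calc (1 - δ) * (g.card : ℝ) * (Fintype.card V : ℝ) ^ Fintype.card J
      = ∑ b ∈ g, (1 - δ) * (Fintype.card V : ℝ) ^ Fintype.card J := by
        rw [Finset.sum_const, nsmul_eq_mul]; ring
    _ ≤ ∑ b ∈ g, ∑ κ ∈ Finset.univ.filter (fun κ => R κ b), (2 : ℝ) ^ (seen b).card := by
        refine Finset.sum_le_sum fun b hb => ?_
        rw [Finset.sum_const, nsmul_eq_mul, mul_comm (_ : ℝ) ((2 : ℝ) ^ _), ← hS]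
        exact hG b (Finset.mem_filter.1 hb).2.1
    _ = ∑ κ ∈ k, ∑ b ∈ g.filter (fun b => R κ b), (2 : ℝ) ^ (seen b).card := by
        refine Finset.sum_comm' fun b κ => ?_
        simp only [g, k, Finset.mem_filter, Finset.mem_univ, true_and]
        constructor
        · rintro ⟨⟨h1, h2⟩, h3⟩
          exact ⟨⟨⟨h1, h2⟩, h3⟩, (hR κ b h3).2.trans h2⟩
        · rintro ⟨⟨⟨h1, h2⟩, h3⟩, _⟩
          exact ⟨⟨h1, h2⟩, h3⟩
    _ ≤ ∑ κ ∈ k, (2 : ℝ) ^ Fintype.card J := Finset.sum_le_sum fun κ _ => hfib κ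
    _ = k.card * 2 ^ Fintype.card J := by rw [Finset.sum_const, nsmul_eq_mul]

/-! ### Stability of the recorded indices -/

/-- The recorded indices. -/
def Hits.toFinset {N : ℕ} : Hits N → Finset (Fin N)
  | Hits.none => ∅
  | Hits.one i => {i}
  | Hits.many i i' _ => {i, i'}

theorem hits_cases {N : ℕ} (s : Finset (Fin N)) :
    (s = ∅ ∧ hits s = Hits.none) ∨ (∃ i, s = {i} ∧ hits s = Hits.one i) ∨
      ∃ i i', ∃ h : i < i', i ∈ s ∧ i' ∈ s ∧ (∀ k ∈ s, k ≠ i → i' ≤ k) ∧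
        hits s = Hits.many i i' h := by
  by_cases h : s.Nonempty
  · by_cases h' : (s.erase (s.min' h)).Nonempty
    · refine Or.inr (Or.inr ⟨s.min' h, (s.erase (s.min' h)).min' h', min_lt_min_erase s h h',
        s.min'_mem h, Finset.mem_of_mem_erase (Finset.min'_mem _ h'), fun k hk hne => ?_, ?_⟩)
      · exact Finset.min'_le _ _ (Finset.mem_erase.2 ⟨hne, hk⟩)
      · rw [hits, dif_pos h, dif_pos h']
    · refine Or.inr (Or.inl ⟨s.min' h, ?_, ?_⟩)
      · rw [Finset.not_nonempty_iff_eq_empty, Finset.erase_eq_empty_iff] at h'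
        exact h'.resolve_left h.ne_empty
      · rw [hits, dif_pos h, dif_neg h']
  · refine Or.inl ⟨Finset.not_nonempty_iff_eq_empty.1 h, ?_⟩
    rw [hits, dif_neg h]

theorem hits_toFinset_subset {N : ℕ} (s : Finset (Fin N)) : (hits s).toFinset ⊆ s := by
  rcases hits_cases s with ⟨_, h⟩ | ⟨i, hs, h⟩ | ⟨i, i', hlt, hi, hi', _, h⟩ <;> rw [h]
  · exact Finset.empty_subset _
  · rw [hs]; exact subset_rfl
  · intro k hk
    rcases Finset.mem_insert.1 hk with rfl | hk
    · exact hi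
    · rw [Finset.mem_singleton.1 hk]; exact hi'

theorem hits_erase {N : ℕ} (s : Finset (Fin N)) (i : Fin N) (hi : i ∉ (hits s).toFinset) :
    hits (s.erase i) = hits s := by
  rcases hits_cases s with ⟨hs, h⟩ | ⟨a, hs, h⟩ | ⟨a, a', hlt, ha, ha', hmin, h⟩
  · rw [hs, Finset.erase_empty]
  · rw [h, Hits.toFinset, Finset.mem_singleton] at hi
    rw [Finset.erase_eq_of_notMem]
    rwa [hs, Finset.mem_singleton]
  · rw [h] at hi ⊢
    simp only [Hits.toFinset, Finset.mem_insert, Finset.mem_singleton, not_or] at hi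
    have ma : a ∈ s.erase i := Finset.mem_erase.2 ⟨fun e => hi.1 e.symm, ha⟩
    have ma' : a' ∈ s.erase i := Finset.mem_erase.2 ⟨fun e => hi.2 e.symm, ha'⟩
    rcases hits_cases (s.erase i) with ⟨hs, _⟩ | ⟨c, hs, _⟩ | ⟨c, c', hlt', hc, hc', hmin', h'⟩
    · rw [hs] at ma; exact absurd ma (Finset.notMem_empty _)
    · rw [hs, Finset.mem_singleton] at ma ma'
      exact absurd (ma.trans ma'.symm) hlt.ne
    · rw [h']
      have mc := Finset.mem_of_mem_erase hc
      have mc' := Finset.mem_of_mem_erase hc'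
      have e1 : c = a := by
        by_contra hne
        exact absurd (hmin' a ma (Ne.symm hne)) (not_le.2 ((hlt.trans_le (hmin c mc hne)).trans hlt'))
      subst e1
      have e2 : c' = a' := le_antisymm (hmin' a' ma' hlt.ne') (hmin c' mc' hlt'.ne')
      subst e2
      rfl

/-- An element that is not recorded comes after the two smallest, so it may leave the set unnoticed.
Therefore a term that is satisfied but not recorded needs no certificate. -/
theorem hits_congr {N : ℕ} {s s' : Finset (Fin N)} (i : Fin N)
    (hne : ∀ j, j ≠ i → (j ∈ s' ↔ j ∈ s)) (h1 : i ∈ (hits s).toFinset → i ∈ s')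
    (h2 : i ∉ s → i ∉ s') : hits s' = hits s := by
  by_cases hi : i ∈ s ↔ i ∈ s'
  · congr 1
    ext j
    by_cases hj : j = i
    · rw [hj, hi]
    · exact hne j hj
  · have his : i ∈ s := by tauto
    have his' : i ∉ s' := by tauto
    rw [← hits_erase s i fun h => his' (h1 h)]
    congr 1
    ext j
    rw [Finset.mem_erase]
    by_cases hj : j = i
    · subst hj; tauto
    · rw [hne j hj]; tauto

/-! ### Families of terms and clauses -/

/-- The index `inl i` stands for the `i`-th term, `inr (i, j)` for the `j`-th clause below it. -/
abbrev Idx (N : ℕ) : Type := Fin N ⊕ (Fin N × Fin N)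

abbrev Fam (n : ℕ) : Type := Idx (numN n) → Fin (width n) → Fin n

/-- Families and pairs `(T, C)` are the same. -/
def famEquiv (n : ℕ) : Fam n ≃ Terms n × Clauses n where
  toFun F := (fun i => F (Sum.inl i), fun i j => F (Sum.inr (i, j)))
  invFun TC := Sum.elim TC.1 fun p => TC.2 p.1 p.2
  left_inv F := by funext α; rcases α with i | ⟨i, j⟩ <;> rfl
  right_inv TC := rfl

@[simp]
theorem famEquiv_fst {n : ℕ} (F : Fam n) (i : Fin (numN n)) :
    (famEquiv n F).1 i = F (Sum.inl i) := rfl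

@[simp]
theorem famEquiv_snd {n : ℕ} (F : Fam n) (i j : Fin (numN n)) :
    (famEquiv n F).2 i j = F (Sum.inr (i, j)) := rfl

/-- The value that the variables of a recorded term or clause take. -/
def polarity {N : ℕ} : Idx N → Bool
  | Sum.inl _ => true
  | Sum.inr _ => false

/-! ### Answers and their dependence on a single term or clause -/

/-- The information in a full signature. -/
inductive Out (N : ℕ) : Type
  | noTerm : Out N
  | manyTerms (i i' : Fin N) (h : i < i') : Out N
  | noClause (i : Fin N) : Out N
  | oneClause (i j : Fin N) (a : Bool) : Out N
  | manyClauses (i j j' : Fin N) (h : j < j') (a b : Bool) : Out N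

namespace Out

variable {N : ℕ}

def toSig : Out N → Sig N
  | noTerm => ⟨_, IsSig.noTerm⟩
  | manyTerms i i' h => ⟨_, IsSig.manyTerms i i' h⟩
  | noClause i => ⟨_, IsSig.noClause i⟩
  | oneClause i j a => ⟨_, IsSig.oneClause i j a⟩
  | manyClauses i j k h a b => ⟨_, IsSig.manyClauses i j k h a b⟩

/-- The value of `f` on a middle-layer string. -/
def value : Out N → Bool
  | noTerm => false
  | manyTerms _ _ _ => true
  | noClause _ => true
  | oneClause _ _ a => a
  | manyClauses _ _ _ _ _ _ => false

/-- The terms seen satisfied and the clauses seen falsified. -/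
def rev : Out N → Finset (Idx N)
  | noTerm => ∅
  | manyTerms i i' _ => {Sum.inl i, Sum.inl i'}
  | noClause i => {Sum.inl i}
  | oneClause i j _ => {Sum.inl i, Sum.inr (i, j)}
  | manyClauses i j j' _ _ _ => {Sum.inl i, Sum.inr (i, j), Sum.inr (i, j')}

theorem card_rev_le (o : Out N) : o.rev.card ≤ 3 := by
  cases o with
  | noTerm => simp [rev]
  | manyTerms i i' h => exact Finset.card_le_two.trans (by norm_num)
  | noClause i => simp [rev]
  | oneClause i j a => exact Finset.card_le_two.trans (by norm_num)
  | manyClauses i j j' h a b => exact Finset.card_le_three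

/-- Clauses are reported only below a satisfied term, so every string that recorded a clause also
recorded its term. -/
theorem inl_mem_rev {o : Out N} {p : Fin N × Fin N} (h : Sum.inr p ∈ o.rev) :
    Sum.inl p.1 ∈ o.rev := by
  cases o <;> simp_all [rev]
  rcases h with rfl | rfl <;> rfl

theorem card_filter_inr_le (o : Out N) :
    (Finset.univ.filter fun p : Fin N × Fin N => Sum.inr p ∈ o.rev).card ≤ 2 := by
  have key : o = noTerm ∨ ∃ u v : Fin N × Fin N, ∀ p, Sum.inr p ∈ o.rev → p = u ∨ p = v := by
    cases o with
    | noTerm => exact Or.inl rfl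
    | manyTerms i i' h => exact Or.inr ⟨(i, i), (i, i), fun p hp => by simp [rev] at hp⟩
    | noClause i => exact Or.inr ⟨(i, i), (i, i), fun p hp => by simp [rev] at hp⟩
    | oneClause i j a => exact Or.inr ⟨(i, j), (i, j), fun p hp => by simpa [rev] using hp⟩
    | manyClauses i j j' h a b =>
      exact Or.inr ⟨(i, j), (i, j'), fun p hp => by simpa [rev] using hp⟩
  rcases key with rfl | ⟨u, v, h⟩
  · simp [rev]
  refine (Finset.card_le_card (t := {u, v}) fun p hp => ?_).trans Finset.card_le_two
  simpa using h p (Finset.mem_filter.1 hp).2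

end Out

/-- The answer to the query `x`, where `b (i, j)` stands for `h_{i,j}(x)`. -/
def ans {n : ℕ} (F : Fam n) (b : Fin (numN n) × Fin (numN n) → Bool) (x : Cube n) :
    Out (numN n) :=
  match hits (satTerms (famEquiv n F).1 x) with
  | Hits.none => Out.noTerm
  | Hits.many i i' h => Out.manyTerms i i' h
  | Hits.one i =>
    match hits (falsClauses (famEquiv n F).2 i x) with
    | Hits.none => Out.noClause i
    | Hits.one j => Out.oneClause i j (b (i, j))
    | Hits.many j j' h => Out.manyClauses i j j' h (b (i, j)) (b (i, j'))

theorem fullSig_eq_toSig_ans {n : ℕ} (F : Fam n) (h : Bottom n) (x : Cube n) :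
    fullSig (famEquiv n F, h) x = (ans F (fun p => h p.1 p.2 x) x).toSig := by
  unfold fullSig ans
  cases hits (satTerms (famEquiv n F).1 x) with
  | none => rfl
  | many i i' h => rfl
  | one i =>
    dsimp only
    cases hits (falsClauses (famEquiv n F).2 i x) <;> rfl

theorem fTCH_eq_value_ans {n : ℕ} (F : Fam n) (h : Bottom n) {x : Cube n}
    (hx : x ∈ middleLayers n) :
    fTCH (famEquiv n F, h) x = (ans F (fun p => h p.1 p.2 x) x).value := by
  unfold fTCH ans mux
  rw [if_neg (not_lt.2 hx.2), if_neg (not_lt.2 hx.1)]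
  dsimp only
  cases hits (satTerms (famEquiv n F).1 x) with
  | none => rfl
  | many i i' h => rfl
  | one i =>
    dsimp only
    cases hits (falsClauses (famEquiv n F).2 i x) <;> rfl

theorem mem_satTerms {n : ℕ} (F : Fam n) (x : Cube n) (i : Fin (numN n)) :
    i ∈ satTerms (famEquiv n F).1 x ↔ ∀ k, x (F (Sum.inl i) k) = true := by
  rw [satTerms, Finset.mem_filter, termVal, decide_eq_true_iff]
  exact and_iff_right (Finset.mem_univ _)

theorem mem_falsClauses {n : ℕ} (F : Fam n) (x : Cube n) (i j : Fin (numN n)) :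
    j ∈ falsClauses (famEquiv n F).2 i x ↔ ∀ k, x (F (Sum.inr (i, j)) k) = false := by
  rw [falsClauses, Finset.mem_filter, clauseVal, decide_eq_false_iff_not, not_exists]
  simp only [Finset.mem_univ, true_and, Bool.not_eq_true, famEquiv_snd]

theorem inl_mem_rev_ans {n : ℕ} (F : Fam n) (b) (x : Cube n) (i : Fin (numN n)) :
    Sum.inl i ∈ (ans F b x).rev ↔ i ∈ (hits (satTerms (famEquiv n F).1 x)).toFinset := by
  unfold ans
  cases hits (satTerms (famEquiv n F).1 x) with
  | none => simp [Out.rev, Hits.toFinset]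
  | many i i' h => simp [Out.rev, Hits.toFinset]
  | one i =>
    dsimp only
    cases hits (falsClauses (famEquiv n F).2 i x) <;> simp [Out.rev, Hits.toFinset]

theorem inr_mem_rev_ans {n : ℕ} (F : Fam n) (b) (x : Cube n) (i j : Fin (numN n)) :
    Sum.inr (i, j) ∈ (ans F b x).rev ↔ hits (satTerms (famEquiv n F).1 x) = Hits.one i ∧
      j ∈ (hits (falsClauses (famEquiv n F).2 i x)).toFinset := by
  unfold ans
  cases hits (satTerms (famEquiv n F).1 x) with
  | none => simp [Out.rev]
  | many i i' h => simp [Out.rev]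
  | one i' =>
    dsimp only
    by_cases hi : i' = i
    · subst hi
      cases hits (falsClauses (famEquiv n F).2 i' x) <;> simp [Out.rev, Hits.toFinset]
    · have hi' : i ≠ i' := Ne.symm hi
      cases hits (falsClauses (famEquiv n F).2 i' x) <;> simp [Out.rev, hi, hi']

/-- Which indices are recorded depends on `(T, C)` alone. For a fixed family, the bits read at a
query are thus determined by the query. -/
theorem rev_ans_congr {n : ℕ} (F : Fam n) (b b') (x : Cube n) :
    (ans F b x).rev = (ans F b' x).rev := by
  ext α
  rcases α with i | ⟨i, j⟩
  · rw [inl_mem_rev_ans, inl_mem_rev_ans]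
  · rw [inr_mem_rev_ans, inr_mem_rev_ans]

theorem ans_congr {n : ℕ} (F : Fam n) (b b') (x : Cube n)
    (h : ∀ p, Sum.inr p ∈ (ans F b x).rev → b p = b' p) : ans F b x = ans F b' x := by
  have h' : ∀ i j, hits (satTerms (famEquiv n F).1 x) = Hits.one i →
      j ∈ (hits (falsClauses (famEquiv n F).2 i x)).toFinset → b (i, j) = b' (i, j) :=
    fun i j h1 h2 => h (i, j) ((inr_mem_rev_ans F b x i j).2 ⟨h1, h2⟩)
  unfold ans
  cases hs : hits (satTerms (famEquiv n F).1 x) with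
  | none => rfl
  | many i i' h => rfl
  | one i =>
    have h'' := fun j => h' i j hs
    dsimp only
    cases hf : hits (falsClauses (famEquiv n F).2 i x) with
    | none => rfl
    | one j => rw [hf] at h''; dsimp only; rw [h'' j (by simp [Hits.toFinset])]
    | many j j' hlt =>
      rw [hf] at h''
      dsimp only
      rw [h'' j (by simp [Hits.toFinset]), h'' j' (by simp [Hits.toFinset])]

theorem apply_eq_polarity_of_mem_rev {n : ℕ} {F : Fam n} {b} {x : Cube n} {α : Idx (numN n)}
    (h : α ∈ (ans F b x).rev) (k : Fin (width n)) : x (F α k) = polarity α := by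
  rcases α with i | ⟨i, j⟩
  · rw [inl_mem_rev_ans] at h
    exact (mem_satTerms F x i).1 (hits_toFinset_subset _ h) k
  · rw [inr_mem_rev_ans] at h
    exact (mem_falsClauses F x i j).1 (hits_toFinset_subset _ h.2) k

/-- The answer does not change when one term or clause is changed without changing its value,
unless that value is not recorded. -/
theorem ans_update {n : ℕ} (F : Fam n) (b) (x : Cube n) (α : Idx (numN n))
    (t : Fin (width n) → Fin n)
    (h1 : α ∈ (ans F b x).rev → ∀ k, x (t k) = polarity α)
    (h2 : (¬ ∀ k, x (F α k) = polarity α) → ¬ ∀ k, x (t k) = polarity α) :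
    ans (Function.update F α t) b x = ans F b x := by
  rcases α with i | ⟨i, j⟩
  · have hT : hits (satTerms (famEquiv n (Function.update F (Sum.inl i) t)).1 x) =
        hits (satTerms (famEquiv n F).1 x) := by
      refine hits_congr i (fun i' hi' => ?_) (fun h => ?_) fun h => ?_
      · rw [mem_satTerms, mem_satTerms, Function.update_of_ne (by simpa using hi')]
      · rw [mem_satTerms, Function.update_self]
        exact h1 ((inl_mem_rev_ans F b x i).2 h)
      · rw [mem_satTerms] at h ⊢
        rw [Function.update_self]
        exact h2 h
    have hC : (famEquiv n (Function.update F (Sum.inl i) t)).2 = (famEquiv n F).2 := by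
      funext i' j'
      simp
    unfold ans
    rw [hT, hC]
  · have hT : (famEquiv n (Function.update F (Sum.inr (i, j)) t)).1 = (famEquiv n F).1 := by
      funext i'
      simp
    have hC : ∀ i', hits (satTerms (famEquiv n F).1 x) = Hits.one i' →
        hits (falsClauses (famEquiv n (Function.update F (Sum.inr (i, j)) t)).2 i' x) =
        hits (falsClauses (famEquiv n F).2 i' x) := by
      intro i' hi'
      by_cases hii : i' = i
      · subst hii
        refine hits_congr j (fun j' hj' => ?_) (fun h => ?_) fun h => ?_
        · rw [mem_falsClauses, mem_falsClauses, Function.update_of_ne (by simpa using hj')]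
        · rw [mem_falsClauses, Function.update_self]
          exact h1 ((inr_mem_rev_ans F b x i' j).2 ⟨hi', h⟩)
        · rw [mem_falsClauses] at h ⊢
          rw [Function.update_self]
          exact h2 h
      · congr 1
        ext j'
        rw [mem_falsClauses, mem_falsClauses, Function.update_of_ne (by simp [hii])]
    unfold ans
    rw [hT]
    cases hs : hits (satTerms (famEquiv n F).1 x) with
    | none => rfl
    | many i i' h => rfl
    | one a =>
      dsimp only
      rw [hC a hs]

/-! ### Common positions and good transcripts -/

/-- The positions at which all strings that recorded `α` take the value `polarity α`. -/
def common {n N : ℕ} (H : List (Cube n × Out N)) (α : Idx N) : Finset (Fin n) :=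
  Finset.univ.filter fun k => ∀ p ∈ H, α ∈ p.2.rev → p.1 k = polarity α

theorem mem_common {n N : ℕ} {H : List (Cube n × Out N)} {α : Idx N} {k : Fin n} :
    k ∈ common H α ↔ ∀ p ∈ H, α ∈ p.2.rev → p.1 k = polarity α := by
  simp [common]

/-- No index recorded before loses more than `Δ` common positions by the answer `o` to `x`. -/
def GoodStep {n N : ℕ} (Δ : ℝ) (x : Cube n) (o : Out N) (H : List (Cube n × Out N)) : Prop :=
  ∀ α ∈ o.rev, (∃ p ∈ H, α ∈ p.2.rev) →
    (((common H α).filter fun k => x k ≠ polarity α).card : ℝ) ≤ Δ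

/-- All steps of the transcript are good. -/
def GoodHist {n N : ℕ} (Δ : ℝ) : List (Cube n × Out N) → Prop
  | [] => True
  | p :: H => GoodStep Δ p.1 p.2 H ∧ GoodHist Δ H

open Classical in
/-- The families that give the answers in `H`. -/
noncomputable def consistent {n : ℕ} (b : Fin (numN n) × Fin (numN n) → Bool)
    (H : List (Cube n × Out (numN n))) : Finset (Fam n) :=
  Finset.univ.filter fun F => ∀ p ∈ H, ans F b p.1 = p.2

theorem mem_consistent {n : ℕ} {b} {H : List (Cube n × Out (numN n))} {F : Fam n} :
    F ∈ consistent b H ↔ ∀ p ∈ H, ans F b p.1 = p.2 := by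
  simp [consistent]

/-- One violated coordinate per element of the list suffices. This supplies the certificate of size
at most the number of queries made. -/
theorem exists_witnesses {β κ : Type*} (Q : β → κ → Prop) (H : List β) :
    ∃ K : Finset κ, K.card ≤ H.length ∧ ∀ p ∈ H, (¬ ∀ k, Q p k) → ∃ k ∈ K, ¬ Q p k := by
  classical
  induction H with
  | nil => exact ⟨∅, by simp, by simp⟩
  | cons p H ih =>
    obtain ⟨K, hK, h⟩ := ih
    by_cases hp : ∀ k, Q p k
    · refine ⟨K, by simp only [List.length_cons]; omega, fun p' hp' hn => ?_⟩
      rcases List.mem_cons.1 hp' with rfl | hp'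
      · exact absurd hp hn
      · exact h p' hp' hn
    · obtain ⟨k, hk⟩ := not_forall.1 hp
      refine ⟨insert k K, (Finset.card_insert_le _ _).trans (by simp only [List.length_cons]; omega),
        fun p' hp' hn => ?_⟩
      rcases List.mem_cons.1 hp' with rfl | hp'
      · exact ⟨k, Finset.mem_insert_self _ _, hk⟩
      · obtain ⟨k', hk', hq⟩ := h p' hp' hn
        exact ⟨k', Finset.mem_insert_of_mem hk', hq⟩

/-- A recorded index rarely loses many common positions when it is recorded again. -/
theorem card_consistent_filter_mem_rev_le {n q : ℕ} (b) (H : List (Cube n × Out (numN n)))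
    (hH : H.length ≤ q) (x : Cube n) (α : Idx (numN n)) {Δ : ℝ} (hΔ : 0 ≤ Δ)
    (hdrop : Δ < ((common H α).filter fun k => x k ≠ polarity α).card) :
    (((consistent b H).filter fun F => α ∈ (ans F b x).rev).card : ℝ) ≤
      Real.exp (-(Δ / n)) ^ (width n - q) * (consistent b H).card := by
  classical
  set A := common H α with hA
  set X := A.filter (fun k => x k = polarity α) with hX
  have hXA : X ⊆ A := Finset.filter_subset _ _
  -- Earlier records place all variables of `F α` in `A`; a record at `x` confines them to `X`.
  have hsub : ((consistent b H).filter fun F => α ∈ (ans F b x).rev) ⊆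
      (consistent b H).filter fun F => ∀ k, F α k ∈ X := by
    intro F hF
    rw [Finset.mem_filter] at hF ⊢
    refine ⟨hF.1, fun k => ?_⟩
    rw [hX, Finset.mem_filter, hA, mem_common]
    refine ⟨fun p hp hα => ?_, apply_eq_polarity_of_mem_rev hF.2 k⟩
    rw [← mem_consistent.1 hF.1 p hp] at hα
    exact apply_eq_polarity_of_mem_rev hα k
  -- The certificate keeps one variable of the wrong value for every earlier query at which not all
  -- variables of `F α` have the right one. At the other queries `α` is either recorded, and stays
  -- so with variables from `A`, or not recorded, and then its value is irrelevant.
  have hcert := card_filter_forall_mem_le_of_update (m := H.length) hXA α (consistent b H) (by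
    intro F hF _
    obtain ⟨K, hK, hw⟩ := exists_witnesses
      (fun (p : Cube n × Out (numN n)) k => p.1 (F α k) = polarity α) H
    refine ⟨K, hK, fun T' hT' hTK => mem_consistent.2 fun p hp => ?_⟩
    rw [ans_update, mem_consistent.1 hF p hp]
    · intro hα k
      rw [mem_consistent.1 hF p hp] at hα
      exact mem_common.1 (hT' k) p hp hα
    · intro hn hall
      obtain ⟨k, hk, hq⟩ := hw p hp hn
      rw [← hTK k hk] at hq
      exact hq (hall k))
  have hsum : (X.card : ℝ) + (A.filter fun k => x k ≠ polarity α).card = A.card := by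
    exact_mod_cast Finset.card_filter_add_card_filter_not (s := A) fun k => x k = polarity α
  have hAn : (A.card : ℝ) ≤ n := by
    exact_mod_cast (Finset.card_le_univ A).trans_eq (Fintype.card_fin n)
  have hApos : (0 : ℝ) < A.card := by
    have : (0 : ℝ) ≤ X.card := Nat.cast_nonneg _
    linarith
  have hratio : (X.card : ℝ) / A.card ≤ Real.exp (-(Δ / n)) := by
    have h1 : Δ / n ≤ Δ / A.card := div_le_div_of_nonneg_left hΔ hApos hAn
    have h2 : (X.card : ℝ) / A.card ≤ 1 - Δ / A.card := by
      rw [div_le_iff₀ hApos, sub_mul, div_mul_cancel₀ _ hApos.ne']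
      linarith
    have h3 := Real.add_one_le_exp (-(Δ / n))
    linarith
  have hle1 : Real.exp (-(Δ / n)) ≤ 1 := Real.exp_le_one_iff.2 (by
    have : 0 ≤ Δ / (n : ℝ) := by positivity
    linarith)
  calc (((consistent b H).filter fun F => α ∈ (ans F b x).rev).card : ℝ)
      ≤ ((consistent b H).filter fun F => ∀ k, F α k ∈ X).card := by
        exact_mod_cast Finset.card_le_card hsub
    _ ≤ ((X.card : ℝ) / A.card) ^ (width n - H.length) * (consistent b H).card := hcert
    _ ≤ Real.exp (-(Δ / n)) ^ (width n - q) * (consistent b H).card := by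
        refine mul_le_mul_of_nonneg_right ?_ (Nat.cast_nonneg _)
        refine (pow_le_pow_left₀ (by positivity) hratio _).trans ?_
        exact pow_le_pow_of_le_one (Real.exp_pos _).le hle1 (by omega)

theorem exists_seen {n N : ℕ} (H : List (Cube n × Out N)) :
    ∃ S : Finset (Idx N), S.card ≤ 3 * H.length ∧ ∀ α, (∃ p ∈ H, α ∈ p.2.rev) → α ∈ S := by
  induction H with
  | nil => exact ⟨∅, by simp, by simp⟩
  | cons p H ih =>
    obtain ⟨S, hS, h⟩ := ih
    refine ⟨p.2.rev ∪ S, ?_, ?_⟩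
    · have := Finset.card_union_le p.2.rev S
      have := p.2.card_rev_le
      simp only [List.length_cons]
      omega
    · rintro α ⟨p', hp', hα⟩
      rcases List.mem_cons.1 hp' with rfl | hp'
      · exact Finset.mem_union_left _ hα
      · exact Finset.mem_union_right _ (h α ⟨p', hp', hα⟩)

open Classical in
/-- With fixed bits, the transcript is good for almost all families. -/
theorem card_not_goodHist_le {n q : ℕ} (b) {Δ : ℝ} (hΔ : 0 ≤ Δ)
    (B : QTree (Cube n) (Out (numN n))) :
    ∀ (H : List (Cube n × Out (numN n))) (d : ℕ), B.DepthLE d → H.length + d ≤ q →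
      GoodHist Δ H →
      (((consistent b H).filter fun F => ¬ GoodHist Δ (B.transcript (ans F b) H)).card : ℝ) ≤
        d * (3 * q * Real.exp (-(Δ / n)) ^ (width n - q)) * (consistent b H).card := by
  set η := Real.exp (-(Δ / n)) ^ (width n - q) with hη
  have hη0 : 0 ≤ η := by positivity
  induction B with
  | leaf l =>
    intro H d _ _ hH
    rw [Finset.filter_false_of_mem (fun F _ h => h hH)]
    simp only [Finset.card_empty, Nat.cast_zero]
    positivity
  | node x child ih =>
    rintro H (_ | d) hd hlen hH
    · exact hd.elim
    set S := consistent b H with hS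
    have hsplit : (S.filter fun F => ¬ GoodHist Δ ((QTree.node x child).transcript (ans F b) H)) ⊆
        (S.filter fun F => ¬ GoodStep Δ x (ans F b x) H) ∪
        (S.filter fun F => GoodStep Δ x (ans F b x) H ∧
          ¬ GoodHist Δ ((child (ans F b x)).transcript (ans F b) ((x, ans F b x) :: H))) := by
      intro F hF
      rw [Finset.mem_filter] at hF
      rw [Finset.mem_union, Finset.mem_filter, Finset.mem_filter]
      by_cases hst : GoodStep Δ x (ans F b x) H
      · exact Or.inr ⟨hF.1, hst, hF.2⟩
      · exact Or.inl ⟨hF.1, hst⟩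
    -- Union bound over the at most `3 * q` indices recorded so far, three per answer.
    have hnow : ((S.filter fun F => ¬ GoodStep Δ x (ans F b x) H).card : ℝ) ≤
        3 * q * η * S.card := by
      obtain ⟨Z, hZ, hZmem⟩ := exists_seen H
      let Z' := Z.filter fun α => Δ < ((common H α).filter fun k => x k ≠ polarity α).card
      have hsub : (S.filter fun F => ¬ GoodStep Δ x (ans F b x) H) ⊆
          Z'.biUnion fun α => S.filter fun F => α ∈ (ans F b x).rev := by
        intro F hF
        rw [Finset.mem_filter] at hF
        obtain ⟨hFS, hF⟩ := hF
        simp only [GoodStep, not_forall, not_le] at hF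
        obtain ⟨α, h1, h2, h3⟩ := hF
        exact Finset.mem_biUnion.2 ⟨α, Finset.mem_filter.2 ⟨hZmem α h2, h3⟩,
          Finset.mem_filter.2 ⟨hFS, h1⟩⟩
      calc ((S.filter fun F => ¬ GoodStep Δ x (ans F b x) H).card : ℝ)
          ≤ ∑ α ∈ Z', ((S.filter fun F => α ∈ (ans F b x).rev).card : ℝ) := by
            exact_mod_cast (Finset.card_le_card hsub).trans Finset.card_biUnion_le
        _ ≤ ∑ α ∈ Z', η * S.card := Finset.sum_le_sum fun α hα =>
            card_consistent_filter_mem_rev_le b H (by omega) x α hΔ (Finset.mem_filter.1 hα).2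
        _ = Z'.card * (η * S.card) := by rw [Finset.sum_const, nsmul_eq_mul]
        _ ≤ (3 * q) * (η * S.card) := by
            refine mul_le_mul_of_nonneg_right ?_ (by positivity)
            have h1 : Z'.card ≤ Z.card := Finset.card_filter_le _ _
            have : Z'.card ≤ 3 * q := by omega
            exact_mod_cast this
        _ = 3 * q * η * S.card := by ring
    -- Given the answer `o`, the remaining families are exactly those consistent with the longer
    -- history, so induction applies on each fiber.
    have hlater : ((S.filter fun F => GoodStep Δ x (ans F b x) H ∧
          ¬ GoodHist Δ ((child (ans F b x)).transcript (ans F b)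
            ((x, ans F b x) :: H))).card : ℝ) ≤ d * (3 * q * η) * S.card := by
      let I := S.image fun F => ans F b x
      rw [Finset.card_eq_sum_card_fiberwise (f := fun F => ans F b x) (t := I)
        (fun F hF => Finset.mem_coe.2 (Finset.mem_image_of_mem _
          (Finset.mem_filter.1 (Finset.mem_coe.1 hF)).1)),
        Finset.card_eq_sum_card_fiberwise (s := S) (f := fun F => ans F b x) (t := I)
        (fun F hF => Finset.mem_coe.2 (Finset.mem_image_of_mem _ (Finset.mem_coe.1 hF)))]
      push_cast
      rw [Finset.mul_sum]
      refine Finset.sum_le_sum fun o _ => ?_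
      have hc : (S.filter fun F => ans F b x = o) = consistent b ((x, o) :: H) := by
        ext F
        simp [hS, mem_consistent, and_comm]
      rw [hc]
      by_cases hst : GoodStep Δ x o H
      · refine le_trans ?_ (ih o ((x, o) :: H) d (hd o) (by simp only [List.length_cons]; omega)
          ⟨hst, hH⟩)
        refine Nat.cast_le.2 (Finset.card_le_card fun F hF => ?_)
        rw [Finset.mem_filter, Finset.mem_filter] at hF
        obtain ⟨⟨hFS, _, hbad⟩, rfl⟩ := hF
        rw [Finset.mem_filter, ← hc, Finset.mem_filter]
        exact ⟨⟨hFS, rfl⟩, hbad⟩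
      · rw [Finset.filter_eq_empty_iff.2]
        · simp only [Finset.card_empty, Nat.cast_zero]
          positivity
        · rintro F hF rfl
          exact hst (Finset.mem_filter.1 hF).2.1
    calc ((S.filter fun F => ¬ GoodHist Δ
          ((QTree.node x child).transcript (ans F b) H)).card : ℝ)
        ≤ 3 * q * η * S.card + d * (3 * q * η) * S.card := by
          refine le_trans ?_ (add_le_add hnow hlater)
          exact_mod_cast (Finset.card_le_card hsplit).trans (Finset.card_union_le _ _)
      _ = ((d + 1 : ℕ) : ℝ) * (3 * q * η) * S.card := by
          push_cast
          ring

/-! ### Sizes of the sets `agree` on a good transcript -/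

/-- The number of strings that recorded `α`. -/
def cnt {n N : ℕ} (H : List (Cube n × Out N)) (α : Idx N) : ℕ :=
  H.countP fun p => decide (α ∈ p.2.rev)

theorem cnt_pos {n N : ℕ} {H : List (Cube n × Out N)} {α : Idx N} :
    0 < cnt H α ↔ ∃ p ∈ H, α ∈ p.2.rev := by
  simp [cnt, List.countP_pos_iff]

theorem cnt_cons {n N : ℕ} (p : Cube n × Out N) (H : List (Cube n × Out N)) (α : Idx N) :
    cnt (p :: H) α = cnt H α + if α ∈ p.2.rev then 1 else 0 := by
  simp [cnt, List.countP_cons]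

theorem sum_cnt_inr_le {n N : ℕ} (H : List (Cube n × Out N)) :
    ∑ p : Fin N × Fin N, cnt H (Sum.inr p) ≤ 2 * H.length := by
  induction H with
  | nil => simp [cnt]
  | cons p H ih =>
    simp only [cnt_cons, Finset.sum_add_distrib, List.length_cons]
    have h := p.2.card_filter_inr_le
    rw [Finset.card_filter] at h
    omega

/-- On a good transcript the common positions of `α` are nearly all positions of the first string
that recorded `α`. -/
theorem exists_card_le_common {n N : ℕ} {Δ : ℝ} {H : List (Cube n × Out N)} (hH : GoodHist Δ H)
    (α : Idx N) (hα : ∃ p ∈ H, α ∈ p.2.rev) :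
    ∃ p ∈ H, α ∈ p.2.rev ∧ ((Finset.univ.filter fun k => p.1 k = polarity α).card : ℝ) ≤
      (common H α).card + ((cnt H α : ℝ) - 1) * Δ := by
  induction H with
  | nil => simp at hα
  | cons p H ih =>
    by_cases hp : α ∈ p.2.rev
    · by_cases hseen : ∃ p ∈ H, α ∈ p.2.rev
      · obtain ⟨p₀, hp₀, h1, h2⟩ := ih hH.2 hseen
        refine ⟨p₀, List.mem_cons_of_mem _ hp₀, h1, ?_⟩
        have hstep := hH.1 α hp hseen
        have hc : common (p :: H) α = (common H α).filter fun k => p.1 k = polarity α := by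
          ext k
          simp [mem_common, hp, and_comm]
        have hsum : (((common H α).filter fun k => p.1 k = polarity α).card : ℝ) +
            ((common H α).filter fun k => p.1 k ≠ polarity α).card = (common H α).card := by
          exact_mod_cast Finset.card_filter_add_card_filter_not (s := common H α)
            fun k => p.1 k = polarity α
        rw [hc, cnt_cons, if_pos hp]
        push_cast
        linarith
      -- At the first record nothing has been lost yet, and `cnt - 1` is 0.
      · refine ⟨p, List.mem_cons_self, hp, ?_⟩
        have hc : common (p :: H) α = Finset.univ.filter fun k => p.1 k = polarity α := by
          ext k
          rw [mem_common, Finset.mem_filter]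
          simp only [List.mem_cons, forall_eq_or_imp, Finset.mem_univ, true_and]
          exact ⟨fun h => h.1 hp, fun h => ⟨fun _ => h, fun p' hp' hα' =>
            absurd ⟨p', hp', hα'⟩ hseen⟩⟩
        have h0 : cnt H α = 0 := by
          by_contra h
          exact hseen (cnt_pos.1 (Nat.pos_of_ne_zero h))
        rw [hc, cnt_cons, if_pos hp, h0]
        simp
    · have hseen : ∃ p ∈ H, α ∈ p.2.rev := by
        obtain ⟨p', hp', h⟩ := hα
        rcases List.mem_cons.1 hp' with rfl | hp'
        · exact absurd h hp
        · exact ⟨p', hp', h⟩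
      obtain ⟨p₀, hp₀, h1, h2⟩ := ih hH.2 hseen
      refine ⟨p₀, List.mem_cons_of_mem _ hp₀, h1, ?_⟩
      have hc : common (p :: H) α = common H α := by
        ext k
        simp [mem_common, hp]
      rw [hc, cnt_cons, if_neg hp, add_zero]
      exact h2

theorem card_filter_true {n : ℕ} (x : Cube n) :
    (Finset.univ.filter fun k => x k = true).card = weight x := rfl

theorem card_filter_false {n : ℕ} (x : Cube n) :
    ((Finset.univ.filter fun k => x k = false).card : ℝ) = n - weight x := by
  have h := Finset.card_filter_add_card_filter_not (s := Finset.univ) fun k => x k = true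
  simp only [Bool.not_eq_true, Finset.card_univ, Fintype.card_fin] at h
  rw [card_filter_true] at h
  rw [eq_sub_iff_add_eq, add_comm]
  exact_mod_cast h

/-- The positions at which all strings that recorded the clause `j` take the value `c`. -/
def agree {n N : ℕ} (H : List (Cube n × Out N)) (j : Fin N × Fin N) (c : Bool) : Finset (Fin n) :=
  Finset.univ.filter fun k => ∀ p ∈ H, Sum.inr j ∈ p.2.rev → p.1 k = c

theorem card_agree_ge {n N q : ℕ} {Δ : ℝ} {H : List (Cube n × Out N)} (hH : GoodHist Δ H)
    (hmid : ∀ p ∈ H, p.1 ∈ middleLayers n) (hlen : H.length ≤ q) (hΔ : 2 * √(n : ℝ) ≤ Δ)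
    (j : Fin N × Fin N) (hj : ∃ p ∈ H, Sum.inr j ∈ p.2.rev) (c : Bool) :
    (n : ℝ) / 2 - 2 * √(q : ℝ) * cnt H (Sum.inr j) * Δ ≤ (agree H j c).card := by
  classical
  have hn0 : 0 ≤ √(n : ℝ) := Real.sqrt_nonneg _
  have hΔ0 : 0 ≤ Δ := by linarith
  have hm : (1 : ℝ) ≤ cnt H (Sum.inr j) := by exact_mod_cast cnt_pos.2 hj
  have hmq' : cnt H (Sum.inr j) ≤ q := List.countP_le_length.trans hlen
  have hmq : (cnt H (Sum.inr j) : ℝ) ≤ q := by exact_mod_cast hmq'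
  obtain ⟨p₀, hp₀, hr₀, hcard₀⟩ := exists_card_le_common hH (Sum.inr j) hj
  change ((Finset.univ.filter fun k => p₀.1 k = false).card : ℝ) ≤ _ at hcard₀
  rw [card_filter_false] at hcard₀
  have hw₀ := hmid p₀ hp₀
  set m : ℝ := (cnt H (Sum.inr j) : ℝ) with hmdef
  set s : ℝ := √(q : ℝ) with hs
  have hs1 : 1 ≤ s := Real.one_le_sqrt.2 (hm.trans hmq)
  have hss : s * s = q := Real.mul_self_sqrt (Nat.cast_nonneg _)
  have hsm : 1 ≤ s * m := one_le_mul_of_one_le_of_one_le hs1 hm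
  have hfirst : √(n : ℝ) ≤ s * m * Δ := by nlinarith
  cases c with
  | false =>
    have hc : agree H j false = common H (Sum.inr j) := rfl
    have h1 : m * Δ ≤ s * m * Δ := by
      refine mul_le_mul_of_nonneg_right ?_ hΔ0
      nlinarith
    rw [hc]
    have := hw₀.2
    linarith
  | true =>
    -- For `m ≥ √q` the term above the clause is used: its common positions are ones of all the
    -- strings, and its loss `q Δ` is at most `√q m Δ`. For `m ≤ √q` the strings are compared with
    -- `p₀`, with loss `m² Δ`.
    rcases le_total (q : ℝ) (m * m) with hqm | hqm
    · have hi : ∃ p ∈ H, Sum.inl j.1 ∈ p.2.rev := by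
        obtain ⟨p, hp, h⟩ := hj
        exact ⟨p, hp, Out.inl_mem_rev h⟩
      obtain ⟨p₁, hp₁, hr₁, hcard₁⟩ := exists_card_le_common hH (Sum.inl j.1) hi
      change ((Finset.univ.filter fun k => p₁.1 k = true).card : ℝ) ≤ _ at hcard₁
      rw [card_filter_true] at hcard₁
      have hw₁ := (hmid p₁ hp₁).1
      have hcq : (cnt H (Sum.inl j.1) : ℝ) ≤ q := by
        exact_mod_cast List.countP_le_length.trans hlen
      have hsub : common H (Sum.inl j.1) ⊆ agree H j true := by
        intro k hk
        rw [agree, Finset.mem_filter]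
        exact ⟨Finset.mem_univ _, fun p hp h => mem_common.1 hk p hp (Out.inl_mem_rev h)⟩
      have hle : ((common H (Sum.inl j.1)).card : ℝ) ≤ (agree H j true).card := by
        exact_mod_cast Finset.card_le_card hsub
      have hsm' : s ≤ m := by
        rw [← hss] at hqm
        exact (mul_self_le_mul_self_iff (by linarith) (by linarith)).2 hqm
      have h1 : (q : ℝ) * Δ ≤ s * m * Δ := by
        refine mul_le_mul_of_nonneg_right ?_ hΔ0
        nlinarith
      have h2 : ((cnt H (Sum.inl j.1) : ℝ) - 1) * Δ ≤ q * Δ :=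
        mul_le_mul_of_nonneg_right (by linarith) hΔ0
      linarith
    · let L : Finset (Cube n × Out N) := (H.filter fun p => decide (Sum.inr j ∈ p.2.rev)).toFinset
      have hL : (L.card : ℝ) ≤ m := by
        rw [hmdef, cnt, List.countP_eq_length_filter]
        exact_mod_cast List.toFinset_card_le _
      have hLmem : ∀ p, p ∈ L ↔ p ∈ H ∧ Sum.inr j ∈ p.2.rev := by
        intro p
        simp [L]
      let D : Cube n × Out N → Finset (Fin n) := fun p =>
        Finset.univ.filter fun k => p₀.1 k = true ∧ p.1 k = false
      -- The common zeros are all but `(m - 1) Δ` of the zeros of `p₀`, so `p` has at most that many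
      -- ones among them. The two weights differ by at most `2 √n ≤ Δ`, so `p` lacks at most `m Δ`
      -- ones of `p₀`.
      have hD : ∀ p ∈ L, ((D p).card : ℝ) ≤ m * Δ := by
        intro p hp
        obtain ⟨hpH, hpr⟩ := (hLmem p).1 hp
        have hw := hmid p hpH
        let E : Finset (Fin n) := Finset.univ.filter fun k => p.1 k = true ∧ p₀.1 k = false
        let I : Finset (Fin n) := Finset.univ.filter fun k => p₀.1 k = true ∧ p.1 k = true
        have e0 : weight p₀.1 = I.card + (D p).card := by
          rw [weight, ← Finset.card_filter_add_card_filter_not (fun k => p.1 k = true),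
            Finset.filter_filter, Finset.filter_filter]
          simp only [Bool.not_eq_true]
          rfl
        have e1 : weight p.1 = I.card + E.card := by
          rw [weight, ← Finset.card_filter_add_card_filter_not (fun k => p₀.1 k = true),
            Finset.filter_filter, Finset.filter_filter]
          simp only [Bool.not_eq_true, I, E]
          congr 3
          ext k
          exact and_comm
        have e2 : E.card + (common H (Sum.inr j)).card ≤
            (Finset.univ.filter fun k => p₀.1 k = false).card := by
          rw [← Finset.card_union_of_disjoint]
          · refine Finset.card_le_card fun k hk => ?_
            rw [Finset.mem_filter]
            refine ⟨Finset.mem_univ _, ?_⟩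
            rcases Finset.mem_union.1 hk with hk | hk
            · exact (Finset.mem_filter.1 hk).2.2
            · exact mem_common.1 hk p₀ hp₀ hr₀
          · rw [Finset.disjoint_left]
            intro k hk hk'
            have h1 := (Finset.mem_filter.1 hk).2.1
            have h2 : p.1 k = false := mem_common.1 hk' p hpH hpr
            rw [h1] at h2
            exact absurd h2 (by simp)
        have e0' : (weight p₀.1 : ℝ) = I.card + (D p).card := by exact_mod_cast e0
        have e1' : (weight p.1 : ℝ) = I.card + E.card := by exact_mod_cast e1
        have e2' : (E.card : ℝ) + (common H (Sum.inr j)).card ≤ n - weight p₀.1 := by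
          rw [← card_filter_false]
          exact_mod_cast e2
        have := hw₀.2
        have := hw.1
        linarith
      have hsub : (Finset.univ.filter fun k => p₀.1 k = true) ⊆
          agree H j true ∪ L.biUnion D := by
        intro k hk
        have hk₀ := (Finset.mem_filter.1 hk).2
        by_cases hka : k ∈ agree H j true
        · exact Finset.mem_union_left _ hka
        · refine Finset.mem_union_right _ ?_
          simp only [agree, Finset.mem_filter, Finset.mem_univ, true_and, not_forall,
            Bool.not_eq_true] at hka
          obtain ⟨p, hp, hr, hpk⟩ := hka
          exact Finset.mem_biUnion.2 ⟨p, (hLmem p).2 ⟨hp, hr⟩,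
            Finset.mem_filter.2 ⟨Finset.mem_univ _, hk₀, hpk⟩⟩
      have hle : (weight p₀.1 : ℝ) ≤ (agree H j true).card + ∑ p ∈ L, ((D p).card : ℝ) := by
        rw [← card_filter_true]
        exact_mod_cast (Finset.card_le_card hsub).trans
          ((Finset.card_union_le _ _).trans (Nat.add_le_add_left Finset.card_biUnion_le _))
      have hsumD : ∑ p ∈ L, ((D p).card : ℝ) ≤ m * (m * Δ) := by
        refine (Finset.sum_le_sum hD).trans ?_
        rw [Finset.sum_const, nsmul_eq_mul]
        exact mul_le_mul_of_nonneg_right hL (by positivity)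
      have hms : m ≤ s := by
        rw [← hss] at hqm
        exact (mul_self_le_mul_self_iff (by linarith) (by linarith)).2 hqm
      have h1 : m * (m * Δ) ≤ s * m * Δ := by
        rw [← mul_assoc]
        exact mul_le_mul_of_nonneg_right (mul_le_mul_of_nonneg_right hms (by linarith)) hΔ0
      have := hw₀.1
      linarith

/-- Weierstrass' product inequality. Values `δ i > 1` are harmless, since they make the left side
negative. -/
theorem one_sub_sum_le_prod {ι : Type*} (s : Finset ι) (a δ : ι → ℝ) (ha : ∀ i, 0 ≤ a i)
    (hδ : ∀ i, 0 ≤ δ i) (h : ∀ i, 1 - δ i ≤ a i) : 1 - ∑ i ∈ s, δ i ≤ ∏ i ∈ s, a i := by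
  classical
  induction s using Finset.induction_on with
  | empty => simp
  | insert i s hi ih =>
    rw [Finset.sum_insert hi, Finset.prod_insert hi]
    have hP : 0 ≤ ∏ i ∈ s, a i := Finset.prod_nonneg fun i _ => ha i
    have hS : 0 ≤ ∑ i ∈ s, δ i := Finset.sum_nonneg fun i _ => hδ i
    rcases le_total 1 (δ i) with h1 | h1
    · have := mul_nonneg (ha i) hP
      linarith
    · nlinarith [mul_le_mul_of_nonneg_right (h i) hP, mul_le_mul_of_nonneg_left ih (sub_nonneg.2 h1),
        mul_nonneg (hδ i) hS]

/-- On a good transcript, the sets `agree` are on average nearly half of all positions. -/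
theorem prod_card_agree_ge {n N q : ℕ} [NeZero n] {Δ : ℝ} {H : List (Cube n × Out N)}
    (hH : GoodHist Δ H) (hmid : ∀ p ∈ H, p.1 ∈ middleLayers n) (hlen : H.length ≤ q)
    (hΔ : 2 * √(n : ℝ) ≤ Δ) (c : Fin N × Fin N → Bool) (seen : Finset (Fin N × Fin N))
    (hseen : ∀ j, j ∈ seen ↔ ∃ p ∈ H, Sum.inr j ∈ p.2.rev) :
    (1 - 8 * (q * √(q : ℝ)) * Δ / n) * (n : ℝ) ^ Fintype.card (Fin N × Fin N) ≤
      2 ^ seen.card * ∏ j, ((agree H j (c j)).card : ℝ) := by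
  classical
  have hn : (0 : ℝ) < n := by exact_mod_cast Nat.pos_of_ne_zero (NeZero.ne n)
  have hΔ0 : 0 ≤ Δ := le_trans (by positivity) hΔ
  -- A recorded clause contributes `2 |agree| / n`. For any other clause `agree` is everything and
  -- the factor is 1.
  have key := one_sub_sum_le_prod Finset.univ
    (fun j => (if j ∈ seen then 2 else 1) * ((agree H j (c j)).card : ℝ) / n)
    (fun j => 4 * √(q : ℝ) * cnt H (Sum.inr j) * Δ / n)
    (fun j => by split_ifs <;> positivity) (fun j => by positivity) (fun j => by
      rw [le_div_iff₀ hn, sub_mul, div_mul_cancel₀ _ hn.ne', one_mul]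
      split_ifs with hj
      · have := card_agree_ge hH hmid hlen hΔ j ((hseen j).1 hj) (c j)
        linarith
      · have h0 : cnt H (Sum.inr j) = 0 := by
          by_contra h
          exact hj ((hseen j).2 (cnt_pos.1 (Nat.pos_of_ne_zero h)))
        have hu : agree H j (c j) = Finset.univ := by
          refine Finset.filter_true_of_mem fun k _ p hp h => ?_
          exact absurd ((hseen j).2 ⟨p, hp, h⟩) hj
        rw [h0, hu]
        simp)
  -- Each answer records at most two clauses, so the counts add up to at most `2 * q`.
  have hsum : ∑ j, 4 * √(q : ℝ) * cnt H (Sum.inr j) * Δ / n ≤ 8 * (q * √(q : ℝ)) * Δ / n := by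
    rw [← Finset.sum_div, ← Finset.sum_mul, ← Finset.mul_sum]
    refine div_le_div_of_nonneg_right (mul_le_mul_of_nonneg_right ?_ hΔ0) hn.le
    have h1 : ∑ j, (cnt H (Sum.inr j) : ℝ) ≤ 2 * q := by
      have := (sum_cnt_inr_le H).trans (Nat.mul_le_mul_left 2 hlen)
      exact_mod_cast this
    calc 4 * √(q : ℝ) * ∑ j, (cnt H (Sum.inr j) : ℝ) ≤ 4 * √(q : ℝ) * (2 * q) :=
          mul_le_mul_of_nonneg_left h1 (by positivity)
      _ = 8 * (q * √(q : ℝ)) := by ring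
  have hprod : ∏ j, ((if j ∈ seen then 2 else 1) * ((agree H j (c j)).card : ℝ) / n) =
      2 ^ seen.card * (∏ j, ((agree H j (c j)).card : ℝ)) /
        (n : ℝ) ^ Fintype.card (Fin N × Fin N) := by
    rw [Finset.prod_div_distrib, Finset.prod_mul_distrib, Finset.prod_ite_mem, Finset.univ_inter,
      Finset.prod_const, Finset.prod_const, Finset.card_univ]
  rw [hprod, le_div_iff₀ (by positivity)] at key
  refine le_trans (mul_le_mul_of_nonneg_right ?_ (by positivity)) key
  linarith

/-! ### The real worlds against the ideal world -/

/-- The pairs that index the functions `h_{i,j}`. -/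
abbrev Pairs (n : ℕ) : Type := Fin (numN n) × Fin (numN n)

/-- The oracle with `h_j(x) = x_{κ j}` for `sgn = false` and `h_j(x) = ¬ x_{κ j}` for
`sgn = true`. -/
def realOracle {n : ℕ} (F : Fam n) (sgn : Bool) (κ : Pairs n → Fin n) (x : Cube n) :
    Out (numN n) :=
  ans F (fun j => xor (x (κ j)) sgn) x

/-- For a fixed family, the real worlds give each outcome nearly the ideal probability. -/
theorem ideal_sub_le_real {n q : ℕ} [NeZero n] {Δ : ℝ} (hΔ : 2 * √(n : ℝ) ≤ Δ)
    (B : QTree (Cube n) (Out (numN n))) (hd : B.DepthLE q) (hq : B.QueriesIn (middleLayers n))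
    (F : Fam n) (sgn l : Bool) :
    (Nat.card {b | B.run (ans F b) = l} : ℝ) / 2 ^ Fintype.card (Pairs n) -
        (Nat.card {b | ¬ GoodHist Δ (B.transcript (ans F b) [])} : ℝ) /
          2 ^ Fintype.card (Pairs n) - 8 * (q * √(q : ℝ)) * Δ / n ≤
      (Nat.card {κ | B.run (realOracle F sgn κ) = l} : ℝ) /
        (n : ℝ) ^ Fintype.card (Pairs n) := by
  classical
  have hn : (0 : ℝ) < n := by exact_mod_cast Nat.pos_of_ne_zero (NeZero.ne n)
  have hΔ0 : 0 ≤ Δ := le_trans (by positivity) hΔ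
  set δ := 8 * (q * √(q : ℝ)) * Δ / n with hδ
  have hδ0 : 0 ≤ δ := by positivity
  let G : Set (Pairs n → Bool) := {b | GoodHist Δ (B.transcript (ans F b) [])}
  let touch : Cube n → Finset (Pairs n) := fun x =>
    Finset.univ.filter fun j => Sum.inr j ∈ (ans F (fun _ => false) x).rev
  have htouch : ∀ b x j, j ∈ touch x ↔ Sum.inr j ∈ (ans F b x).rev := by
    intro b x j
    rw [Finset.mem_filter, rev_ans_congr F _ b x]
    simp
  have htr : ∀ b, ∀ p ∈ B.transcript (ans F b) [], p.2 = ans F b p.1 := fun b =>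
    QTree.eq_oracle_of_mem_transcript (ans F b) B [] (by simp)
  have htr' : ∀ b, ∀ p ∈ B.transcript (ans F b) [], ∀ j, j ∈ touch p.1 ↔ Sum.inr j ∈ p.2.rev :=
    fun b p hp j => by rw [htr b p hp, htouch b]
  let seen : (Pairs n → Bool) → Finset (Pairs n) := fun b =>
    Finset.univ.filter fun j => ∃ p ∈ B.transcript (ans F b) [], j ∈ touch p.1
  have hseen : ∀ b j, j ∈ seen b ↔ ∃ p ∈ B.transcript (ans F b) [], j ∈ touch p.1 := by
    intro b j
    simp [seen]
  have key := ideal_le_real (V := Fin n) (fun b x => ans F b x) touch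
    (fun b b' x h => ans_congr F b b' x fun j hj => h j ((htouch b x j).2 hj))
    (fun x v => xor (x v) sgn) B l δ G seen hseen (by
      intro b hb
      -- Independence over the clauses: the matching `κ` form a product of the sets `agree`. A sign
      -- only flips the prescribed values, and the bound on `agree` holds for both.
      have hset : {κ : Pairs n → Fin n | ∀ p ∈ B.transcript (ans F b) [], ∀ j ∈ touch p.1,
          xor (p.1 (κ j)) sgn = b j} = ↑(Fintype.piFinset fun j =>
            agree (B.transcript (ans F b) []) j (xor (b j) sgn)) := by
        ext κ
        simp only [Set.mem_ofPred_eq, Finset.mem_coe, Fintype.mem_piFinset, agree,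
          Finset.mem_filter, Finset.mem_univ, true_and]
        constructor
        · intro h j p hp hj
          rw [← h p hp j ((htr' b p hp j).2 hj)]
          simp
        · intro h p hp j hj
          rw [h j p hp ((htr' b p hp j).1 hj)]
          simp
      have hcard : (Nat.card {κ : Pairs n → Fin n | ∀ p ∈ B.transcript (ans F b) [],
          ∀ j ∈ touch p.1, xor (p.1 (κ j)) sgn = b j} : ℝ) =
          ∏ j, ((agree (B.transcript (ans F b) []) j (xor (b j) sgn)).card : ℝ) := by
        rw [hset, Nat.card_coe_set_eq, Set.ncard_coe_finset, Fintype.card_piFinset]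
        push_cast
        rfl
      rw [hcard, Fintype.card_fin]
      refine prod_card_agree_ge (H := B.transcript (ans F b) []) hb
        (QTree.queriesIn_transcript _ B hq [] (by simp)) ?_ hΔ (fun j => xor (b j) sgn) _ ?_
      · simpa using QTree.length_transcript_le (ans F b) B [] q hd
      · intro j
        rw [hseen]
        exact exists_congr fun p => and_congr_right fun hp => htr' b p hp j)
  rw [Fintype.card_fin] at key
  set M : ℝ := 2 ^ Fintype.card (Pairs n) with hM
  have hM0 : 0 < M := by positivity
  set g : ℝ := (Nat.card {b | b ∈ G ∧ B.run (ans F b) = l} : ℝ) with hg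
  have hgM : g / M ≤ 1 := by
    rw [div_le_one hM0]
    have h := Finite.card_subtype_le (fun b : Pairs n → Bool => b ∈ G ∧ B.run (ans F b) = l)
    rw [Nat.card_eq_fintype_card (α := Pairs n → Bool), Fintype.card_fun, Fintype.card_bool] at h
    have h' : ((Nat.card {b | b ∈ G ∧ B.run (ans F b) = l} : ℕ) : ℝ) ≤
        ((2 ^ Fintype.card (Pairs n) : ℕ) : ℝ) := Nat.cast_le.2 h
    rwa [Nat.cast_pow, Nat.cast_ofNat] at h'
  have hsplit : (Nat.card {b | B.run (ans F b) = l} : ℝ) ≤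
      g + Nat.card {b | ¬ GoodHist Δ (B.transcript (ans F b) [])} := by
    simp only [hg, Nat.card_coe_set_eq]
    have hsub : {b | B.run (ans F b) = l} ⊆ {b | b ∈ G ∧ B.run (ans F b) = l} ∪
        {b | ¬ GoodHist Δ (B.transcript (ans F b) [])} := by
      intro b hb
      by_cases h : GoodHist Δ (B.transcript (ans F b) [])
      · exact Or.inl ⟨h, hb⟩
      · exact Or.inr h
    exact_mod_cast (Set.ncard_le_ncard hsub (Set.toFinite _)).trans (Set.ncard_union_le _ _)
  have h1 : (Nat.card {b | B.run (ans F b) = l} : ℝ) / M ≤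
      g / M + (Nat.card {b | ¬ GoodHist Δ (B.transcript (ans F b) [])} : ℝ) / M := by
    rw [← add_div]
    exact div_le_div_of_nonneg_right hsplit hM0.le
  have h2 : g / M - δ ≤ (1 - δ) * (g / M) := by nlinarith
  have h3 : (1 - δ) * (g / M) ≤ (Nat.card {κ | B.run (realOracle F sgn κ) = l} : ℝ) /
      (n : ℝ) ^ Fintype.card (Pairs n) := key
  linarith

/-- The probability of the outcome `l` in the real world. -/
noncomputable def realProb {n : ℕ} (B : QTree (Cube n) (Out (numN n))) (sgn l : Bool) : ℝ :=
  (∑ F : Fam n, (Nat.card {κ | B.run (realOracle F sgn κ) = l} : ℝ) /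
    (n : ℝ) ^ Fintype.card (Pairs n)) / Fintype.card (Fam n)

/-- The probability of the outcome `l` when the functions `h_{i,j}` are random constants. -/
noncomputable def idealProb {n : ℕ} (B : QTree (Cube n) (Out (numN n))) (l : Bool) : ℝ :=
  (∑ F : Fam n, (Nat.card {b | B.run (ans F b) = l} : ℝ) / 2 ^ Fintype.card (Pairs n)) /
    Fintype.card (Fam n)

theorem natCard_add_natCard_eq {α : Type*} [Fintype α] (r : α → Bool) :
    (Nat.card {a | r a = true} : ℝ) + Nat.card {a | r a = false} = Fintype.card α := by
  classical
  have h := Finset.card_filter_add_card_filter_not (s := (Finset.univ : Finset α))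
    fun a => r a = true
  simp only [Bool.not_eq_true] at h
  rw [Nat.card_eq_fintype_card, Nat.card_eq_fintype_card, Fintype.card_subtype,
    Fintype.card_subtype]
  exact_mod_cast h

theorem card_fam_pos (n : ℕ) [NeZero n] : (0 : ℝ) < Fintype.card (Fam n) := by
  exact_mod_cast Fintype.card_pos

theorem realProb_add {n : ℕ} [NeZero n] (B : QTree (Cube n) (Out (numN n))) (sgn : Bool) :
    realProb B sgn true + realProb B sgn false = 1 := by
  have hn : (0 : ℝ) < n := by exact_mod_cast Nat.pos_of_ne_zero (NeZero.ne n)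
  rw [realProb, realProb, ← add_div, ← Finset.sum_add_distrib, div_eq_one_iff_eq
    (card_fam_pos n).ne', Finset.sum_congr rfl (g := fun _ => (1 : ℝ)), Finset.sum_const,
    nsmul_eq_mul, mul_one, Finset.card_univ]
  intro F _
  rw [← add_div, natCard_add_natCard_eq, div_eq_one_iff_eq (by positivity), Fintype.card_fun,
    Fintype.card_fin]
  push_cast
  rfl

theorem idealProb_add {n : ℕ} [NeZero n] (B : QTree (Cube n) (Out (numN n))) :
    idealProb B true + idealProb B false = 1 := by
  rw [idealProb, idealProb, ← add_div, ← Finset.sum_add_distrib, div_eq_one_iff_eq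
    (card_fam_pos n).ne', Finset.sum_congr rfl (g := fun _ => (1 : ℝ)), Finset.sum_const,
    nsmul_eq_mul, mul_one, Finset.card_univ]
  intro F _
  rw [← add_div, natCard_add_natCard_eq, div_eq_one_iff_eq (by positivity), Fintype.card_fun,
    Fintype.card_bool]
  push_cast
  rfl

/-- The error of one comparison with the ideal world, for `q` queries and the threshold `Δ`. -/
noncomputable def gap (n q : ℕ) (Δ : ℝ) : ℝ :=
  q * (3 * q * Real.exp (-(Δ / n)) ^ (width n - q)) + 8 * (q * √(q : ℝ)) * Δ / n

theorem idealProb_sub_gap_le {n q : ℕ} [NeZero n] {Δ : ℝ} (hΔ : 2 * √(n : ℝ) ≤ Δ)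
    (B : QTree (Cube n) (Out (numN n))) (hd : B.DepthLE q) (hq : B.QueriesIn (middleLayers n))
    (sgn l : Bool) : idealProb B l - gap n q Δ ≤ realProb B sgn l := by
  classical
  have hΔ0 : 0 ≤ Δ := le_trans (by positivity) hΔ
  have hF := card_fam_pos n
  set M : ℝ := 2 ^ Fintype.card (Pairs n) with hM
  have hM0 : 0 < M := by positivity
  set e : ℝ := q * (3 * q * Real.exp (-(Δ / n)) ^ (width n - q)) with he
  -- The average over `F` and `b` is taken in the other order, because bad transcripts are rare over
  -- `F` for each fixed `b`.
  have hbad : ∑ F : Fam n, (Nat.card {b | ¬ GoodHist Δ (B.transcript (ans F b) [])} : ℝ) / M ≤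
      e * Fintype.card (Fam n) := by
    rw [← Finset.sum_div, div_le_iff₀ hM0]
    have hswap : ∑ F : Fam n, (Nat.card {b | ¬ GoodHist Δ (B.transcript (ans F b) [])} : ℝ) =
        ∑ b : Pairs n → Bool, ((Finset.univ.filter fun F =>
          ¬ GoodHist Δ (B.transcript (ans F b) [])).card : ℝ) := by
      simp only [Nat.card_eq_fintype_card, Fintype.card_subtype, Finset.card_filter,
        Set.coe_ofPred]
      push_cast
      exact Finset.sum_comm
    rw [hswap]
    have hone : ∀ b : Pairs n → Bool, ((Finset.univ.filter fun F =>
          ¬ GoodHist Δ (B.transcript (ans F b) [])).card : ℝ) ≤ e * Fintype.card (Fam n) := by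
      intro b
      have h := card_not_goodHist_le b hΔ0 B [] q hd (q := q) (by simp) trivial
      have hc : consistent b ([] : List (Cube n × Out (numN n))) = Finset.univ := by
        ext F
        simp [mem_consistent]
      rwa [hc, Finset.card_univ] at h
    refine (Finset.sum_le_sum fun b _ => hone b).trans_eq ?_
    rw [Finset.sum_const, nsmul_eq_mul, Finset.card_univ, Fintype.card_fun, Fintype.card_bool]
    push_cast
    rw [hM]
    ring
  have hsum := Finset.sum_le_sum fun F (_ : F ∈ (Finset.univ : Finset (Fam n))) =>
    ideal_sub_le_real hΔ B hd hq F sgn l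
  rw [Finset.sum_sub_distrib, Finset.sum_sub_distrib, Finset.sum_const, nsmul_eq_mul,
    Finset.card_univ] at hsum
  rw [idealProb, realProb, gap, sub_le_iff_le_add, div_add' _ _ _ hF.ne',
    div_le_div_iff_of_pos_right hF]
  linarith

/-- The lower bound for rejection in the yes-world is an upper bound for acceptance there; the lower
bound for acceptance in the no-world completes the comparison. -/
theorem realProb_le {n q : ℕ} [NeZero n] {Δ : ℝ} (hΔ : 2 * √(n : ℝ) ≤ Δ)
    (B : QTree (Cube n) (Out (numN n))) (hd : B.DepthLE q) (hq : B.QueriesIn (middleLayers n)) :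
    realProb B false true ≤ realProb B true true + 2 * gap n q Δ := by
  have h1 := idealProb_sub_gap_le hΔ B hd hq false false
  have h2 := idealProb_sub_gap_le hΔ B hd hq true true
  have h3 := realProb_add B false
  have h4 := idealProb_add B
  linarith

/-! ### Probabilities as normalized counts -/

/-- The distributions `𝓔_yes` (`sgn = false`) and `𝓔_no` (`sgn = true`). -/
noncomputable def distH (n : ℕ) [NeZero n] (sgn : Bool) : PMF (Bottom n) :=
  (PMF.uniformOfFintype (Fin (numN n) → Fin (numN n) → Fin n)).map
    fun κ i j x => xor (x (κ i j)) sgn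

theorem distEyes_eq (n : ℕ) [NeZero n] : distEyes n = distH n false := by
  simp [distEyes, distH]

theorem distEno_eq (n : ℕ) [NeZero n] : distEno n = distH n true := by
  simp [distEno, distH]

theorem Pr_tripleLaw {n : ℕ} [NeZero n] (sgn : Bool) (S : Set (Triple n)) :
    Pr (tripleLaw (distH n sgn)) S =
      (∑ F : Fam n, (Nat.card {κ : Pairs n → Fin n |
        (famEquiv n F, fun i j x => xor (x (κ (i, j))) sgn) ∈ S} : ℝ) /
          (n : ℝ) ^ Fintype.card (Pairs n)) / Fintype.card (Fam n) := by
  classical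
  have hcard : Fintype.card (Fin (numN n) → Fin (numN n) → Fin n) =
      n ^ Fintype.card (Pairs n) := by
    rw [← Fintype.card_congr (Equiv.curry (Fin (numN n)) (Fin (numN n)) (Fin n)),
      Fintype.card_fun, Fintype.card_fin]
  have hn : n ^ Fintype.card (Pairs n) ≠ 0 := pow_ne_zero _ (NeZero.ne n)
  have hone : ∀ TC : Terms n × Clauses n,
      (((distH n sgn).map fun H => (TC, H)).toOuterMeasure S) =
        ((Nat.card {κ : Pairs n → Fin n |
          (TC, fun i j x => xor (x (κ (i, j))) sgn) ∈ S} : ℕ) : ENNReal) /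
            ((n ^ Fintype.card (Pairs n) : ℕ) : ENNReal) := by
    intro TC
    rw [PMF.toOuterMeasure_map_apply, distH, PMF.toOuterMeasure_map_apply,
      PMF.toOuterMeasure_uniformOfFintype_apply, hcard, ← Nat.card_eq_fintype_card]
    congr 2
    exact (Nat.card_congr ((Equiv.curry (Fin (numN n)) (Fin (numN n)) (Fin n)).subtypeEquiv
      fun κ => Iff.rfl)).symm
  rw [Pr, tripleLaw, PMF.toOuterMeasure_bind_apply, tsum_fintype, ENNReal.toReal_sum]
  · rw [← Equiv.sum_comp (famEquiv n), Finset.sum_div]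
    refine Finset.sum_congr rfl fun F _ => ?_
    rw [hone, distE, PMF.uniformOfFintype_apply, ENNReal.toReal_mul, ENNReal.toReal_inv,
      ENNReal.toReal_div, ENNReal.toReal_natCast, ENNReal.toReal_natCast, ENNReal.toReal_natCast,
      ← Fintype.card_congr (famEquiv n), Nat.cast_pow, div_eq_inv_mul _ (Fintype.card (Fam n) : ℝ)]
  · intro TC _
    rw [hone]
    refine ENNReal.mul_ne_top (PMF.apply_ne_top _ _)
      (ENNReal.div_ne_top (ENNReal.natCast_ne_top _) ?_)
    exact_mod_cast hn

theorem Pr_run_fullSig {n : ℕ} [NeZero n] (sgn : Bool) (B : QTree (Cube n) (Sig (numN n))) :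
    Pr (tripleLaw (distH n sgn)) {ω | B.run (fullSig ω) = true} =
      realProb (B.comapAnswer Out.toSig) sgn true := by
  rw [Pr_tripleLaw, realProb]
  congr 1
  refine Finset.sum_congr rfl fun F _ => ?_
  congr 4
  ext κ
  rw [Set.mem_ofPred_eq, Set.mem_ofPred_eq, Set.mem_ofPred_eq, QTree.run_comapAnswer]
  have h : fullSig (famEquiv n F, fun i j x => xor (x (κ (i, j))) sgn) =
      fun x => (realOracle F sgn κ x).toSig := by
    funext x
    exact fullSig_eq_toSig_ans F _ x
  rw [h]

/-! ### Simulation of queries to `f` -/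

open Classical in
/-- The algorithm that computes the values of `f` from the answers of the stronger oracle and does
not ask for strings outside the middle layers. -/
noncomputable def simulate {n : ℕ} : QTree (Cube n) Bool → QTree (Cube n) (Out (numN n))
  | QTree.leaf l => QTree.leaf l
  | QTree.node x child =>
    if (n : ℝ) / 2 + Real.sqrt n < weight x then simulate (child true)
    else if (weight x : ℝ) < (n : ℝ) / 2 - Real.sqrt n then simulate (child false)
    else QTree.node x fun o => simulate (child o.value)

theorem depthLE_succ {X A : Type} (B : QTree X A) : ∀ d, B.DepthLE d → B.DepthLE (d + 1) := by
  induction B with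
  | leaf l => exact fun _ _ => trivial
  | node x child ih =>
    rintro (_ | d) hd
    · exact hd.elim
    · exact fun a => ih a d (hd a)

theorem depthLE_simulate {n : ℕ} (B : QTree (Cube n) Bool) :
    ∀ d, B.DepthLE d → (simulate B).DepthLE d := by
  induction B with
  | leaf l => exact fun _ _ => trivial
  | node x child ih =>
    rintro (_ | d) hd
    · exact hd.elim
    · rw [simulate]
      split_ifs
      -- Outside the middle layers the value of `f` is known, so the query is saved.
      · exact depthLE_succ _ d (ih _ d (hd _))
      · exact depthLE_succ _ d (ih _ d (hd _))
      · exact fun o => ih _ d (hd _)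

theorem queriesIn_simulate {n : ℕ} (B : QTree (Cube n) Bool) :
    (simulate B).QueriesIn (middleLayers n) := by
  induction B with
  | leaf l => trivial
  | node x child ih =>
    rw [simulate]
    split_ifs with h1 h2
    · exact ih _
    · exact ih _
    · exact ⟨⟨not_lt.1 h2, not_lt.1 h1⟩, fun o => ih _⟩

theorem run_simulate {n : ℕ} (F : Fam n) (sgn : Bool) (κ : Pairs n → Fin n)
    (B : QTree (Cube n) Bool) :
    (simulate B).run (realOracle F sgn κ) =
      B.run (fTCH (famEquiv n F, fun i j x => xor (x (κ (i, j))) sgn)) := by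
  induction B with
  | leaf l => rfl
  | node x child ih =>
    rw [simulate]
    split_ifs with h1 h2
    · rw [ih, QTree.run, fTCH, if_pos h1]
    · rw [ih, QTree.run, fTCH, if_neg h1, if_pos h2]
    · rw [QTree.run, ih, QTree.run, fTCH_eq_value_ans F _ ⟨not_lt.1 h2, not_lt.1 h1⟩]
      rfl

theorem Pr_run_fTCH {n : ℕ} [NeZero n] (sgn : Bool) (B : QTree (Cube n) Bool) :
    Pr ((tripleLaw (distH n sgn)).map fTCH) {f | B.run f = true} =
      realProb (simulate B) sgn true := by
  have h : Pr ((tripleLaw (distH n sgn)).map fTCH) {f | B.run f = true} =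
      Pr (tripleLaw (distH n sgn)) {ω | B.run (fTCH ω) = true} := by
    rw [Pr, Pr, PMF.toOuterMeasure_map_apply]
    rfl
  rw [h, Pr_tripleLaw, realProb]
  congr 1
  refine Finset.sum_congr rfl fun F _ => ?_
  congr 4
  ext κ
  rw [Set.mem_ofPred_eq, Set.mem_ofPred_eq, Set.mem_ofPred_eq, run_simulate]

/-! ### Asymptotics -/

/-- The threshold for the loss of common positions. -/
noncomputable def threshold (n : ℕ) : ℝ := 4 * √(n : ℝ) * Real.log n

theorem numQ_pow_three_le {n : ℕ} (hn : 3 ≤ n) :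
    (numQ n : ℝ) ^ 3 ≤ n / Real.log n ^ 6 := by
  have hlog : 0 < Real.log n := Real.log_pos (by exact_mod_cast (by omega : 1 < n))
  have h : (numQ n : ℝ) ≤ (n : ℝ) ^ (1 / 3 : ℝ) / Real.log n ^ 2 :=
    Nat.floor_le (by positivity)
  calc (numQ n : ℝ) ^ 3 ≤ ((n : ℝ) ^ (1 / 3 : ℝ) / Real.log n ^ 2) ^ 3 :=
        pow_le_pow_left₀ (Nat.cast_nonneg _) h 3
    _ = n / Real.log n ^ 6 := by
        rw [div_pow, ← Real.rpow_natCast ((n : ℝ) ^ (1 / 3 : ℝ)), ← Real.rpow_mul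
          (Nat.cast_nonneg _), ← pow_mul]
        norm_num

theorem one_le_log {n : ℕ} (hn : 3 ≤ n) : 1 ≤ Real.log n := by
  rw [Real.le_log_iff_exp_le (by positivity)]
  have h : (3 : ℝ) ≤ n := by exact_mod_cast hn
  linarith [Real.exp_one_lt_d9]

/-- The threshold makes the failure probability at most `n⁻²` per index and step, against `3 q² ≤ 3
n` such events. It keeps the other term at `8 (√n / log³ n) (4 √n log n) / n = 32 / log² n`. -/
theorem gap_le {n : ℕ} (hn : 4096 ≤ n) :
    gap n (numQ n) (threshold n) ≤ 3 / n + 32 / Real.log n ^ 2 := by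
  have hL := one_le_log (n := n) (by omega)
  have hq3 := numQ_pow_three_le (n := n) (by omega)
  set L := Real.log n with hLdef
  set q := numQ n with hq
  set s := √(n : ℝ) with hs
  have hn0 : (0 : ℝ) < n := by exact_mod_cast (by omega : 0 < n)
  have hss : s * s = n := Real.mul_self_sqrt hn0.le
  have hthr : threshold n = 4 * s * L := rfl
  have hs64 : 64 ≤ s := by
    refine Real.le_sqrt_of_sq_le ?_
    have : (4096 : ℝ) ≤ n := by exact_mod_cast hn
    linarith
  have hq3' : (q : ℝ) ^ 3 ≤ n := hq3.trans (div_le_self hn0.le (one_le_pow₀ hL))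
  have hq2 : (q : ℝ) * q ≤ n := by
    rcases Nat.eq_zero_or_pos q with h0 | h0
    · rw [h0]; simp
    · have h1 : (1 : ℝ) ≤ q := by exact_mod_cast h0
      nlinarith
  -- Otherwise `q³ > s³ / 64 ≥ s² = n`, as `s ≥ 64`; this is the reason for `4096 = 64²`.
  have hqs : (q : ℝ) ≤ s / 4 := by
    by_contra h
    push Not at h
    have h3 : (s / 4) ^ 3 < (q : ℝ) ^ 3 := pow_lt_pow_left₀ h (by linarith) (by norm_num)
    nlinarith [mul_nonneg (mul_self_nonneg s) (sub_nonneg.2 hs64)]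
  have hw : s < width n + 1 := by
    have h1 : (n : ℝ) < ((width n : ℝ) + 1) ^ 2 := by
      exact_mod_cast Nat.lt_succ_sqrt' n
    exact (Real.sqrt_lt' (by positivity)).2 h1
  have hwq : s / 2 ≤ ((width n - q : ℕ) : ℝ) := by
    have h1 : (width n : ℝ) ≤ ((width n - q : ℕ) : ℝ) + q := by
      exact_mod_cast (by omega : width n ≤ width n - q + q)
    linarith
  -- At least `s / 2` free variables, each contributing `4 L / s` to the exponent, give `exp (-2 L)
  -- = n⁻²`.
  have hη : Real.exp (-(threshold n / n)) ^ (width n - q) ≤ 1 / ((n : ℝ) * n) := by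
    have h1 : ((width n - q : ℕ) : ℝ) * -(threshold n / n) ≤ -(L + L) := by
      have h2 : threshold n / n = 4 * L / s := by
        rw [hthr, ← hss]
        field_simp
      have h3 : s / 2 * (4 * L / s) = L + L := by
        field_simp
        ring
      have h4 : s / 2 * (4 * L / s) ≤ ((width n - q : ℕ) : ℝ) * (4 * L / s) :=
        mul_le_mul_of_nonneg_right hwq (by positivity)
      rw [h2]
      linarith
    rw [← Real.exp_nat_mul]
    refine (Real.exp_le_exp.2 h1).trans_eq ?_
    rw [Real.exp_neg, Real.exp_add, hLdef, Real.exp_log hn0, one_div]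
  have hfirst : q * (3 * q * Real.exp (-(threshold n / n)) ^ (width n - q)) ≤ 3 / (n : ℝ) := by
    calc q * (3 * q * Real.exp (-(threshold n / n)) ^ (width n - q))
        = 3 * ((q : ℝ) * q) * Real.exp (-(threshold n / n)) ^ (width n - q) := by ring
      _ ≤ 3 * n * (1 / ((n : ℝ) * n)) := by gcongr
      _ = 3 / n := by field_simp
  have hqq : (q : ℝ) * √(q : ℝ) ≤ s / L ^ 3 := by
    refine abs_le_of_sq_le_sq' ?_ (by positivity) |>.2
    rw [mul_pow, Real.sq_sqrt (Nat.cast_nonneg _), div_pow, sq s, hss, ← pow_mul]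
    calc (q : ℝ) ^ 2 * q = (q : ℝ) ^ 3 := by ring
      _ ≤ _ := hq3
  have hsecond : 8 * (q * √(q : ℝ)) * threshold n / n ≤ 32 / L ^ 2 := by
    have h1 : 0 ≤ threshold n := by rw [threshold]; positivity
    calc 8 * (q * √(q : ℝ)) * threshold n / n ≤ 8 * (s / L ^ 3) * threshold n / n := by gcongr
      _ = 32 / L ^ 2 := by
        rw [hthr, ← hss]
        field_simp
        ring
  exact add_le_add hfirst hsecond

/-- The error term. -/
noncomputable def err (n : ℕ) : ℝ := if 3 ≤ n then 2 * gap n (numQ n) (threshold n) else 1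

theorem tendsto_err : Filter.Tendsto err Filter.atTop (nhds 0) := by
  have hlog : Filter.Tendsto (fun n : ℕ => Real.log n) Filter.atTop Filter.atTop :=
    Real.tendsto_log_atTop.comp tendsto_natCast_atTop_atTop
  have h1 : Filter.Tendsto (fun n : ℕ => 3 / (n : ℝ)) Filter.atTop (nhds 0) :=
    Filter.Tendsto.const_div_atTop tendsto_natCast_atTop_atTop 3
  have h2 : Filter.Tendsto (fun n : ℕ => 32 / Real.log n ^ 2) Filter.atTop (nhds 0) :=
    Filter.Tendsto.const_div_atTop ((Filter.tendsto_pow_atTop two_ne_zero).comp hlog) 32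
  have h3 : Filter.Tendsto (fun n : ℕ => 2 * (3 / (n : ℝ) + 32 / Real.log n ^ 2)) Filter.atTop
      (nhds 0) := by
    simpa using (h1.add h2).const_mul 2
  refine squeeze_zero' ?_ ?_ h3
  · filter_upwards [Filter.eventually_ge_atTop 4096] with n hn
    rw [err, if_pos (by omega), gap, threshold]
    have := one_le_log (n := n) (by omega)
    positivity
  · filter_upwards [Filter.eventually_ge_atTop 4096] with n hn
    rw [err, if_pos (by omega)]
    exact mul_le_mul_of_nonneg_left (gap_le hn) (by norm_num)

theorem realProb_nonneg {n : ℕ} (B : QTree (Cube n) (Out (numN n))) (sgn l : Bool) :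
    0 ≤ realProb B sgn l := by
  unfold realProb
  positivity

theorem realProb_le_add_err {n : ℕ} [NeZero n] (B : QTree (Cube n) (Out (numN n)))
    (hd : B.DepthLE (numQ n)) (hq : B.QueriesIn (middleLayers n)) :
    realProb B false true ≤ realProb B true true + err n := by
  -- From `n = 3` on `log n ≥ 1`, so the threshold exceeds `2 √n`. For smaller `n` the error 1 makes
  -- the bound trivial.
  by_cases hn : 3 ≤ n
  · rw [err, if_pos hn]
    refine realProb_le ?_ B hd hq
    have h1 := one_le_log hn
    have h2 := Real.sqrt_nonneg (n : ℝ)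
    rw [threshold]
    nlinarith
  · rw [err, if_neg hn]
    linarith [realProb_add B false, realProb_nonneg B false false, realProb_nonneg B true true]

end MonoLB

theorem mainTheorem2 :
    (∃ ε : ℕ → ℝ, Filter.Tendsto ε Filter.atTop (nhds 0) ∧
      ∀ (n : ℕ) [NeZero n] (B : MonoLB.QTree (MonoLB.Cube n) (MonoLB.Sig (MonoLB.numN n))),
        B.DepthLE (MonoLB.numQ n) → B.QueriesIn (MonoLB.middleLayers n) →
          MonoLB.Pr (MonoLB.tripleLaw (MonoLB.distEyes n))
              {ω | B.run (MonoLB.fullSig ω) = true} ≤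
            MonoLB.Pr (MonoLB.tripleLaw (MonoLB.distEno n))
              {ω | B.run (MonoLB.fullSig ω) = true} + ε n) ∧
    (∃ ε : ℕ → ℝ, Filter.Tendsto ε Filter.atTop (nhds 0) ∧
      ∀ (n : ℕ) [NeZero n] (B : MonoLB.QTree (MonoLB.Cube n) Bool),
        B.DepthLE (MonoLB.numQ n) →
          MonoLB.Pr (MonoLB.distDyes n) {f | B.run f = true} ≤
            MonoLB.Pr (MonoLB.distDno n) {f | B.run f = true} + ε n) := by
  refine ⟨⟨MonoLB.err, MonoLB.tendsto_err, fun n _ B hd hq => ?_⟩,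
    ⟨MonoLB.err, MonoLB.tendsto_err, fun n _ B hd => ?_⟩⟩
  · rw [MonoLB.distEyes_eq, MonoLB.distEno_eq, MonoLB.Pr_run_fullSig, MonoLB.Pr_run_fullSig]
    exact MonoLB.realProb_le_add_err _ (MonoLB.QTree.depthLE_comapAnswer _ B _ hd)
      (MonoLB.QTree.queriesIn_comapAnswer _ B hq)
  · rw [MonoLB.distDyes, MonoLB.distDno, MonoLB.distEyes_eq, MonoLB.distEno_eq,
      MonoLB.Pr_run_fTCH, MonoLB.Pr_run_fTCH]
    exact MonoLB.realProb_le_add_err _ (MonoLB.depthLE_simulate B _ hd)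
      (MonoLB.queriesIn_simulate B)
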